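/- Let $d\ge 3$, $A=\{1,\dots,d\}$, and let $\sigma$ be the substitution $1\mapsto 12$, $k\mapsto k+1$ $(2\le k\le d-1)$, $d\mapsto 1$, also regarded as an endomorphism of the free group $F_d=F(A)$ (in fact an automorphism); elements of $F_d$ are identified with reduced words, with length $|\cdot|$ and empty word $\epsilon$. Its language is the set of finite words occurring in some $\sigma^n(a)$, $n\ge 0$, $a\in A$; a word $u$ of the language is bispecial if there are letters $a\ne b$ with $au,bu$ in the language and letters $a'\neq b'$ with $ua',ub'$ in the language. Consider finite oriented trees whose edges $(x,y,i)$ (from $x$ to $y$) are coloured by $i\in\{1,\dots,2d-2\}$. Let $\tau$ be the tree substitution that replaces an edge $(x,y,1)$ by $(x,y,d)$; an edge $(x,y,2)$ by the edges $(z,x,d)$, $(z,y,1)$ and $(z,z_h,d+h)$ for $1\le h\le d-2$, where $z,z_1,\dots,z_{d-2}$ are new vertices (distinct ones for distinct edges); an edge $(x,y,d+1)$ by $(x,y,1)$; and an edge $(x,y,i)$ by $(x,y,i-1)$ for all other $i$. Let $T_0^s=\tau^{d-1}(X_2)$, where $X_2$ is a tree with a single edge, of colour $2$. It is a star with edges $(x_0,x_j,j)$,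 $1\le j\le d$, and its centre $x_0$ is called the root. Let $T_n^s=\tau^n(T_0^s)$ for $n\ge 0$; every vertex of $T_n^s$ is a vertex of $T_{n+1}^s$. A branch point of $T_n^s$ is a vertex of degree $d$. For a vertex $x$ of $T_n^s$ let $\gamma_n(x_0,x)$ be the word read along the shortest path from $x_0$ to $x$ in $T_n^s$, an edge of colour $i$ contributing $i$ if it is followed in its direction and $\overline{i}$ otherwise. Let $p_*$ be the morphism to $F_d$ with $p_*(k)=k$ for $1\le k\le d$, $p_*(d+k)=\sigma^k(1)$ for $1\le k\le d-2$, and $p_*(\overline{i})=p_*(i)^{-1}$. For a branch point $x$ of some $T_n^s$ put $f_0(x)=\sigma^k(p_*(\gamma_k(x_0,x)))$, where $k$ is any integer such that $x$ is a vertex of $T_k^s$. For $k\ge 1$, a word $w\in F_d$ appears at step $k$ if $w=\sigma^k(p_*(\gamma_k(x_0,x)))$ for some branch point $x$ of $T_k^s$ that is not a vertex of $T_{k-1}^s$. By convention, $\epsilon$ appears at step $-(d-2)$, and no other word appears at a step $\le 0$ (nor does $\epsilon$ appear at another step $\le 0$). Let $l_0=\epsilon$, $l_m=\sigma^{m-1}(1^{-1})$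 for $1\le m\le d-1$, and, for $m\ge d$, $l_m=\sigma^{\alpha_0}(1^{-1})\sigma^{\alpha_1}(1^{-1})\cdots\sigma^{\alpha_n}(1^{-1})$, where $\alpha_0$ is the remainder of $m-1$ modulo $d-1$, $\alpha_i=\alpha_{i-1}+(d-1)$ for $1\le i\le n$, and $\alpha_n=m-1$. Then $l_m$ is the inverse of a bispecial word for every $m\ge 1$, and: 1. For $1\le m\le d-1$, $l_m$ appears at step $m$ and is the only word that appears at step $m$. 2. For $m\ge d$, $l_m$ appears at step $m$, and every other word that appears at step $m$ is strictly shorter than $l_m$. 3. For every $m\ge 0$ and every branch point $x$ of $T_m^s$, the value $f_0(x)$ is well defined (it does not depend on the choice of $k$) and is a suffix of $l_m$. 4. For every $m\ge 0$, every suffix of $l_m$ appears at some step $k\le m$ ($k\in\mathbb{Z}$). -/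

import Mathlib

namespace TreeSub

/-- The alphabet `A = {1, …, d}`. -/
abbrev Letter (d : ℕ) : Type := {k : ℕ // 1 ≤ k ∧ k ≤ d}

/-- The colours `A_τ = {1, …, 2d-2}` of the edges. -/
abbrev Colour (d : ℕ) : Type := {k : ℕ // 1 ≤ k ∧ k ≤ 2 * d - 2}

/-- The letter `1`. -/
def letterOne {d : ℕ} (hd : 3 ≤ d) : Letter d := ⟨1, by omega⟩

/-! ### The substitution and its language -/

/-- The substitution `1 ↦ 12`, `k ↦ k+1` for `2 ≤ k ≤ d-1`, `d ↦ 1`, on letters. -/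
def sigmaLetter {d : ℕ} (hd : 3 ≤ d) (a : Letter d) : List (Letter d) :=
  if a.1 = 1 then [⟨1, by omega⟩, ⟨2, by omega⟩]
  else if h : a.1 + 1 ≤ d then [⟨a.1 + 1, by omega⟩]
  else [⟨1, by omega⟩]

/-- The substitution on finite words, extended by concatenation. -/
def sigmaWord {d : ℕ} (hd : 3 ≤ d) (u : List (Letter d)) : List (Letter d) :=
  u.flatMap (sigmaLetter hd)

/-- The element of the free group `F_d = F(A)` represented by a word on `A`. -/
def ofWord {d : ℕ} (u : List (Letter d)) : FreeGroup (Letter d) :=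
  (u.map FreeGroup.of).prod

/-- The substitution, seen as an endomorphism of the free group. -/
def sigma {d : ℕ} (hd : 3 ≤ d) : FreeGroup (Letter d) →* FreeGroup (Letter d) :=
  FreeGroup.lift fun a => ofWord (sigmaLetter hd a)

/-- The language of the symbolic system generated by the (primitive) substitution: the words that
occur in some `σⁿ(a)`. -/
def language {d : ℕ} (hd : 3 ≤ d) : Set (List (Letter d)) :=
  {u | ∃ (n : ℕ) (a : Letter d), u <:+: (sigmaWord hd)^[n] [a]}

/-- `u` is a bispecial factor: it belongs to the language, and so do `au`, `bu` for two distinct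
letters `a`, `b`, and `ua`, `ub` for two distinct letters `a`, `b`. -/
def IsBispecial {d : ℕ} (hd : 3 ≤ d) (u : List (Letter d)) : Prop :=
  u ∈ language hd ∧
  (∃ a b : Letter d, a ≠ b ∧ a :: u ∈ language hd ∧ b :: u ∈ language hd) ∧
  (∃ a b : Letter d, a ≠ b ∧ u ++ [a] ∈ language hd ∧ u ++ [b] ∈ language hd)

/-- `w` is a suffix of `u` in `F(A)`: the reduced word of `w` is a suffix of that of `u`. -/
def IsSuffix {d : ℕ} (w u : FreeGroup (Letter d)) : Prop := w.toWord <:+ u.toWord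

/-- The words `l_m`: `l_0 = ε`, `l_m = σ^{m-1}(1⁻¹)` for `1 ≤ m ≤ d-1`, and
`l_m = σ^{α_0}(1⁻¹) ⋯ σ^{α_n}(1⁻¹)` for `m ≥ d`, where `α_0` is the remainder of `m-1` modulo
`d-1`, `α_i = α_{i-1} + (d-1)` and `α_n = m-1` (so that `n` is the quotient of `m-1` by `d-1`). -/
def lWord {d : ℕ} (hd : 3 ≤ d) (m : ℕ) : FreeGroup (Letter d) :=
  if m = 0 then 1
  else if m ≤ d - 1 then (sigma hd)^[m - 1] (FreeGroup.of (letterOne hd))⁻¹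
  else ((List.range ((m - 1) / (d - 1) + 1)).map fun i =>
    (sigma hd)^[(m - 1) % (d - 1) + i * (d - 1)] (FreeGroup.of (letterOne hd))⁻¹).prod

/-! ### Coloured oriented graphs and their path function -/

/-- An oriented graph with vertices in `V` and edges `(x, y, a)` coloured by `C`. -/
structure ColouredGraph (V C : Type*) where
  verts : Set V
  edges : Set (V × V × C)

/-- The graph with the single edge `(x, y, a)`. -/
def singleEdge {V C : Type*} (x y : V) (a : C) : ColouredGraph V C where
  verts := {x, y}
  edges := {(x, y, a)}

/-- The degree of `x`: the number of edges that have `x` as an end. -/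
noncomputable def degree {V C : Type*} (X : ColouredGraph V C) (x : V) : ℕ :=
  {e ∈ X.edges | e.1 = x ∨ e.2.1 = x}.ncard

/-- `IsPathWord X x y w`: some path of `X` from `x` to `y` reads the word `w` over `C ∪ C̄`. The
letter `(a, true)` is `a` (an edge of colour `a` followed in its direction), and `(a, false)` is
`ā` (an edge of colour `a` followed backwards). -/
inductive IsPathWord {V C : Type*} (X : ColouredGraph V C) : V → V → List (C × Bool) → Prop
  | nil (x : V) (hx : x ∈ X.verts) : IsPathWord X x x []
  | forward (x y z : V) (a : C) (w : List (C × Bool)) (he : (x, y, a) ∈ X.edges)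
      (h : IsPathWord X y z w) : IsPathWord X x z ((a, true) :: w)
  | backward (x y z : V) (a : C) (w : List (C × Bool)) (he : (y, x, a) ∈ X.edges)
      (h : IsPathWord X y z w) : IsPathWord X x z ((a, false) :: w)

/-- The path function `γ_X`: the word read along the shortest path from `x` to `y` (which is
unique when `X` is a tree). -/
noncomputable def pathFun {V C : Type*} (X : ColouredGraph V C) (x y : V) : List (C × Bool) :=
  Classical.epsilon fun w =>
    IsPathWord X x y w ∧ ∀ w', IsPathWord X x y w' → w.length ≤ w'.length

/-! ### The tree substitution -/

/-- The set of available vertices: the two ends of the initial edge, and, for every pair `x`, `y`,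
the new vertices that the image of an edge `(x, y, 2)` adds. Naming a new vertex by the edge that
creates it makes the new vertices of distinct edges distinct. -/
inductive Vertex : Type
  | source : Vertex
  | target : Vertex
  | centre (x y : Vertex) : Vertex
  | leaf (x y : Vertex) (h : ℕ) : Vertex

/-- The image of the tree with the single edge `(x, y, 2)`: the edges `(z, x, d)` and `(z, y, 1)`,
which form a path from `x` to `y` through a new vertex `z`, and the edges `(z, z_h, d+h)`,
`1 ≤ h ≤ d-2`, to new vertices `z_h`. -/
def imageTwo {d : ℕ} (hd : 3 ≤ d) (x y : Vertex) : ColouredGraph Vertex (Colour d) where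
  verts := {x, y, .centre x y} ∪ {v | ∃ h : ℕ, 1 ≤ h ∧ h ≤ d - 2 ∧ v = .leaf x y h}
  edges :=
    {(.centre x y, x, ⟨d, by omega⟩), (.centre x y, y, ⟨1, by omega⟩)} ∪
      {e | ∃ (h : ℕ) (h1 : 1 ≤ h) (h2 : h ≤ d - 2),
        e = (.centre x y, .leaf x y h, ⟨d + h, by omega⟩)}

/-- The tree substitution `τ` on the tree `X_i` with the single edge `(x, y, i)`: `τ(X_1) = X_d`,
`τ(X_2)` is `imageTwo`, `τ(X_{d+1}) = X_1`, and `τ(X_i) = X_{i-1}` for the other `i`. -/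
def tauEdge {d : ℕ} (hd : 3 ≤ d) (e : Vertex × Vertex × Colour d) :
    ColouredGraph Vertex (Colour d) :=
  if h1 : e.2.2.1 = 1 then singleEdge e.1 e.2.1 ⟨d, by omega⟩
  else if e.2.2.1 = 2 then imageTwo hd e.1 e.2.1
  else if e.2.2.1 = d + 1 then singleEdge e.1 e.2.1 ⟨1, by omega⟩
  else singleEdge e.1 e.2.1 ⟨e.2.2.1 - 1, by have := e.2.2.2; omega⟩

/-- The extension of `τ` to all trees: the union of the images of the edges. -/
def tau {d : ℕ} (hd : 3 ≤ d) (X : ColouredGraph Vertex (Colour d)) :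
    ColouredGraph Vertex (Colour d) where
  verts := ⋃ e ∈ X.edges, (tauEdge hd e).verts
  edges := ⋃ e ∈ X.edges, (tauEdge hd e).edges

/-- The tree `T_0^s = τ^{d-1}(X_2)`. -/
def treeZero {d : ℕ} (hd : 3 ≤ d) : ColouredGraph Vertex (Colour d) :=
  (tau hd)^[d - 1] (singleEdge .source .target ⟨2, by omega⟩)

/-- The tree `T_n^s = τ^n(T_0^s)`. -/
def tree {d : ℕ} (hd : 3 ≤ d) (n : ℕ) : ColouredGraph Vertex (Colour d) :=
  (tau hd)^[n] (treeZero hd)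

/-- The root `x_0`, the centre of the star `T_0^s`. -/
def root : Vertex := .centre .source .target

/-- The set of branch points (vertices of degree `d`) of `T_n^s`. -/
def branchPoints {d : ℕ} (hd : 3 ≤ d) (n : ℕ) : Set Vertex :=
  {x ∈ (tree hd n).verts | degree (tree hd n) x = d}

/-! ### Words attached to branch points -/

/-- The value of `p_*` on a colour: `p_*(k) = k` for `1 ≤ k ≤ d`, and `p_*(d+k) = σ^k(1)` for
`1 ≤ k ≤ d-2`. -/
def pColour {d : ℕ} (hd : 3 ≤ d) (c : Colour d) : FreeGroup (Letter d) :=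
  if h : c.1 ≤ d then FreeGroup.of ⟨c.1, c.2.1, h⟩
  else (sigma hd)^[c.1 - d] (FreeGroup.of (letterOne hd))

/-- The morphism `p_*` from words over `A_τ ∪ Ā_τ` to `F_d`, with `p_*(k̄) = p_*(k)⁻¹`. -/
def pStar {d : ℕ} (hd : 3 ≤ d) (w : List (Colour d × Bool)) : FreeGroup (Letter d) :=
  (w.map fun c => if c.2 then pColour hd c.1 else (pColour hd c.1)⁻¹).prod

/-- The element `σ^k(p_*(γ_k(x_0, x)))` of `F_d`, where `γ_k` is the path function of `T_k^s`. -/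
noncomputable def wordAt {d : ℕ} (hd : 3 ≤ d) (k : ℕ) (x : Vertex) : FreeGroup (Letter d) :=
  (sigma hd)^[k] (pStar hd (pathFun (tree hd k) root x))

/-- The map `f_0`: `x ↦ σ^k(p_*(γ_k(x_0, x)))`, where `k` is such that `x` is a vertex of `T_k^s`
(the value does not depend on `k`; the least such `k` is taken here). -/
noncomputable def fZero {d : ℕ} (hd : 3 ≤ d) (x : Vertex) : FreeGroup (Letter d) :=
  wordAt hd (sInf {k | x ∈ (tree hd k).verts}) x

/-- `AppearsAt hd k w`: the word `w` appears at step `k`. For `k ≥ 1` this means that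
`w = σ^k(p_*(γ_k(x_0, x)))` for some branch point `x` of `T_k^s` that is not a vertex of
`T_{k-1}^s`. By convention, the empty word appears at step `-(d-2)`, and nothing else appears at a
step `≤ 0`. -/
def AppearsAt {d : ℕ} (hd : 3 ≤ d) (k : ℤ) (w : FreeGroup (Letter d)) : Prop :=
  if k ≤ 0 then k = -((d : ℤ) - 2) ∧ w = 1
  else ∃ x ∈ branchPoints hd k.toNat,
    x ∉ (tree hd (k.toNat - 1)).verts ∧ w = wordAt hd k.toNat x

end TreeSub

namespace TreeSub

/-! ### Positive words in the free group -/

/-! Count time by the applications of the tree substitution to the single edge of colour 2. Tree `n`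
is then stage `n + (d - 1)`, and the root is created at time 1. Every edge has a clock, the number
of steps left before its colour is 2, and its source is always a branch point once time is positive.
The clocks of the `d` edges leaving a new branch point take consecutive values. So a branch point
created at time `s` has exactly one child at each time `t` with `s + (d-1) ≤ t ≤ s + (2d-2)`.

The word attached to a vertex is a difference of potentials, in which an edge of colour `c` at stage
`t` weighs `σ^t(p_*(c))`. Substituting is compatible with these weights, so old vertices keep their
words, and a child created at time `t` multiplies its parent's word on the right by `σ^{t-d}(1)⁻¹`.
All the words are therefore inverses of positive words. No cancellation occurs, and suffixes become
prefixes of the inverses.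

The problem is now combinatorial (`BranchWord`): start from `ε` at time 1, and at time `t` put
`σ^{t-d}(1)` in front of the word of an allowed parent. Always taking the latest parent gives the
inverses of the `l_m` (`specialWord`). These form a chain of prefixes, because `σ^{n+1}(1) = σ^n(1)
σ^{n-(d-1)}(1)` for `n ≥ d-1`. Hence the latest parent gives the longest word, and any other word is
a prefix of it (`BranchWord.prefix`). Conversely, every prefix is reached in time
(`exists_branchWord_of_prefix`). `appearsAt_iff` is the bridge between the trees and this recursion.
Bispeciality is separate, and comes from applying `σ` to known extensions. -/

theorem ofWord_append {d : ℕ} (u v : List (Letter d)) :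
    ofWord (u ++ v) = ofWord u * ofWord v := by
  simp [ofWord]

theorem ofWord_eq_mk {d : ℕ} (u : List (Letter d)) :
    ofWord u = FreeGroup.mk (u.map fun a => (a, true)) := by
  induction u with
  | nil => rfl
  | cons a u ih =>
    have : ofWord (a :: u) = FreeGroup.of a * ofWord u := by simp [ofWord]
    rw [this, ih, FreeGroup.of, FreeGroup.mul_mk]
    rfl

theorem toWord_ofWord {d : ℕ} (u : List (Letter d)) :
    (ofWord u).toWord = u.map fun a => (a, true) := by
  rw [ofWord_eq_mk, FreeGroup.toWord_mk]
  apply FreeGroup.IsReduced.reduce_eq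
  rw [FreeGroup.IsReduced, List.isChain_map]
  induction u with
  | nil => exact List.isChain_nil
  | cons a u ih =>
    cases u with
    | nil => exact List.isChain_singleton _
    | cons b u => exact List.isChain_cons_cons.2 ⟨fun _ => rfl, ih⟩

theorem toWord_ofWord_inv {d : ℕ} (u : List (Letter d)) :
    (ofWord u)⁻¹.toWord = (u.map fun a => (a, false)).reverse := by
  rw [FreeGroup.toWord_inv, toWord_ofWord, FreeGroup.invRev, List.map_map]
  rfl

theorem norm_ofWord_inv {d : ℕ} (u : List (Letter d)) : (ofWord u)⁻¹.norm = u.length := by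
  rw [FreeGroup.norm, toWord_ofWord_inv]
  simp

/-- The suffixes of the inverse of a positive word are the inverses of its prefixes. -/
theorem isSuffix_ofWord_inv_iff {d : ℕ} (w : FreeGroup (Letter d)) (v : List (Letter d)) :
    IsSuffix w (ofWord v)⁻¹ ↔ ∃ u, u <+: v ∧ w = (ofWord u)⁻¹ := by
  rw [IsSuffix, toWord_ofWord_inv]
  constructor
  · intro h
    rw [← List.reverse_prefix, List.reverse_reverse] at h
    obtain ⟨t, ht⟩ := h
    obtain ⟨u, u', rfl, hu, -⟩ := List.map_eq_append_iff.1 ht.symm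
    refine ⟨u, List.prefix_append _ _, ?_⟩
    rw [← FreeGroup.toWord_inj, toWord_ofWord_inv, hu, List.reverse_reverse]
  · rintro ⟨u, hu, rfl⟩
    rw [toWord_ofWord_inv, List.reverse_suffix]
    exact hu.map _

/-! ### The substitution on words -/

section

variable {d : ℕ} (hd : 3 ≤ d)

theorem sigmaWord_append (u v : List (Letter d)) :
    sigmaWord hd (u ++ v) = sigmaWord hd u ++ sigmaWord hd v := by
  simp [sigmaWord]

theorem sigmaWord_iterate_append (n : ℕ) (u v : List (Letter d)) :
    (sigmaWord hd)^[n] (u ++ v) = (sigmaWord hd)^[n] u ++ (sigmaWord hd)^[n] v := by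
  induction n generalizing u v with
  | zero => rfl
  | succ n ih => simp only [Function.iterate_succ_apply, sigmaWord_append, ih]

theorem sigmaWord_singleton (a : Letter d) : sigmaWord hd [a] = sigmaLetter hd a := by
  simp [sigmaWord]

theorem sigma_ofWord (u : List (Letter d)) : sigma hd (ofWord u) = ofWord (sigmaWord hd u) := by
  induction u with
  | nil => simp [ofWord, sigmaWord]
  | cons a u ih =>
    rw [← List.singleton_append, ofWord_append, map_mul, ih, sigmaWord_append, ofWord_append,
      sigmaWord_singleton]
    simp [ofWord, sigma]

theorem sigma_iterate_ofWord (n : ℕ) (u : List (Letter d)) :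
    (sigma hd)^[n] (ofWord u) = ofWord ((sigmaWord hd)^[n] u) := by
  induction n generalizing u with
  | zero => rfl
  | succ n ih => rw [Function.iterate_succ_apply, sigma_ofWord, ih, Function.iterate_succ_apply]

/-- The word `σⁿ(1)`. -/
def sigmaOne (n : ℕ) : List (Letter d) := (sigmaWord hd)^[n] [letterOne hd]

theorem sigmaWord_iterate_sigmaOne (k n : ℕ) :
    (sigmaWord hd)^[k] (sigmaOne hd n) = sigmaOne hd (n + k) := by
  rw [sigmaOne, ← Function.iterate_add_apply, Nat.add_comm, sigmaOne]

theorem sigma_iterate_of_one (n : ℕ) :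
    (sigma hd)^[n] (FreeGroup.of (letterOne hd)) = ofWord (sigmaOne hd n) := by
  rw [sigmaOne, ← sigma_iterate_ofWord]
  simp [ofWord]

theorem sigmaWord_iterate_letter (j k : ℕ) (hk : 2 ≤ k) (hjk : k + j ≤ d) :
    (sigmaWord hd)^[j] [⟨k, by omega, by omega⟩] = [(⟨k + j, by omega, hjk⟩ : Letter d)] := by
  induction j with
  | zero => rfl
  | succ j ih =>
    rw [Function.iterate_succ_apply', ih (by omega), sigmaWord_singleton, sigmaLetter,
      if_neg (by simp only; omega), dif_pos (by simp only; omega)]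
    rfl

theorem sigmaWord_iterate_letter_wrap (k : ℕ) (hk : 2 ≤ k) (hkd : k ≤ d) :
    (sigmaWord hd)^[d - k + 1] [⟨k, by omega, hkd⟩] = [letterOne hd] := by
  rw [Function.iterate_succ_apply', sigmaWord_iterate_letter hd (d - k) k hk (by omega),
    sigmaWord_singleton, sigmaLetter, if_neg (by simp only; omega), dif_neg (by simp only; omega)]
  rfl

theorem sigmaOne_zero : sigmaOne hd 0 = [letterOne hd] := rfl

theorem sigmaOne_one : sigmaOne hd 1 = [letterOne hd, ⟨2, by omega, by omega⟩] := by
  rw [sigmaOne, Function.iterate_one, sigmaWord_singleton, sigmaLetter, letterOne, if_pos rfl]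

theorem sigmaOne_succ (n : ℕ) :
    sigmaOne hd (n + 1) = sigmaOne hd n ++ (sigmaWord hd)^[n] [⟨2, by omega, by omega⟩] := by
  have h : sigmaOne hd (n + 1) = (sigmaWord hd)^[n] (sigmaOne hd 1) := by
    rw [sigmaWord_iterate_sigmaOne, Nat.add_comm]
  rw [h, sigmaOne_one, ← List.singleton_append, sigmaWord_iterate_append]
  rfl

theorem sigmaOne_succ_of_lt (n : ℕ) (hn : n + 2 ≤ d) :
    sigmaOne hd (n + 1) = sigmaOne hd n ++ [⟨2 + n, by omega, by omega⟩] := by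
  rw [sigmaOne_succ, sigmaWord_iterate_letter hd n 2 le_rfl (by omega)]

/-- Since `σ^{d-1}(2) = 1`, the second factor of `σ^n(12)` is again an image of `1`. -/
theorem sigmaOne_succ_of_le (n : ℕ) (hn : d - 1 ≤ n) :
    sigmaOne hd (n + 1) = sigmaOne hd n ++ sigmaOne hd (n - (d - 1)) := by
  have h : (sigmaWord hd)^[n] [(⟨2, by omega, by omega⟩ : Letter d)]
      = (sigmaWord hd)^[n - (d - 1)] ((sigmaWord hd)^[d - 2 + 1] [⟨2, by omega, by omega⟩]) := by
    rw [← Function.iterate_add_apply]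
    congr 2
    omega
  rw [sigmaOne_succ, h, sigmaWord_iterate_letter_wrap hd 2 le_rfl (by omega)]
  rfl

theorem sigmaOne_prefix {m n : ℕ} (h : m ≤ n) : sigmaOne hd m <+: sigmaOne hd n := by
  induction n, h using Nat.le_induction with
  | base => exact List.prefix_rfl
  | succ n _ ih => exact ih.trans (sigmaOne_succ hd n ▸ List.prefix_append _ _)

/-! ### The inverses of the words `l_m` -/

/-- The positive word `σ^{m-1}(1) σ^{m-1-(d-1)}(1) ⋯`, the inverse of `l_m`. -/
def specialWord (m : ℕ) : List (Letter d) :=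
  if m = 0 then [] else sigmaOne hd (m - 1) ++ specialWord (m - (d - 1))
termination_by m

theorem specialWord_zero : specialWord hd 0 = [] := by
  rw [specialWord, if_pos rfl]

theorem specialWord_of_pos {m : ℕ} (hm : 1 ≤ m) :
    specialWord hd m = sigmaOne hd (m - 1) ++ specialWord hd (m - (d - 1)) := by
  rw [specialWord, if_neg (by omega)]

theorem specialWord_of_lt {m : ℕ} (hm : 1 ≤ m) (hmd : m ≤ d - 1) :
    specialWord hd m = sigmaOne hd (m - 1) := by
  rw [specialWord_of_pos hd hm, Nat.sub_eq_zero_of_le hmd, specialWord_zero, List.append_nil]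

theorem lWord_eq_prod {m : ℕ} (hm : 1 ≤ m) :
    lWord hd m = ((List.range ((m - 1) / (d - 1) + 1)).map fun i =>
      (sigma hd)^[(m - 1) % (d - 1) + i * (d - 1)] (FreeGroup.of (letterOne hd))⁻¹).prod := by
  rw [lWord, if_neg (by omega)]
  split_ifs with h
  · rw [Nat.div_eq_of_lt (by omega), Nat.mod_eq_of_lt (by omega)]
    simp
  · rfl

/-- Removing the last factor of the product leaves `l_{m-(d-1)}`. Inversion turns that last factor
into the leading block. -/
theorem lWord_eq (m : ℕ) : lWord hd m = (ofWord (specialWord hd m))⁻¹ := by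
  induction m using Nat.strong_induction_on with
  | _ m ih =>
    rcases Nat.eq_zero_or_pos m with rfl | hm
    · rw [specialWord_zero, lWord, if_pos rfl]
      simp [ofWord]
    rcases Nat.lt_or_ge (d - 1) m with h | h
    · have hlast : (sigma hd)^[m - 1] (FreeGroup.of (letterOne hd))⁻¹
          = (ofWord (sigmaOne hd (m - 1)))⁻¹ := by
        rw [iterate_map_inv, sigma_iterate_of_one]
      have hq : (m - 1) / (d - 1) = (m - (d - 1) - 1) / (d - 1) + 1 := by
        rw [show m - 1 = m - (d - 1) - 1 + (d - 1) by omega, Nat.add_div_right _ (by omega)]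
      have hr : (m - 1) % (d - 1) = (m - (d - 1) - 1) % (d - 1) := by
        rw [show m - 1 = m - (d - 1) - 1 + (d - 1) by omega, Nat.add_mod_right]
      have he : (m - 1) % (d - 1) + ((m - 1) / (d - 1)) * (d - 1) = m - 1 := by
        rw [Nat.mul_comm]
        exact Nat.mod_add_div _ _
      rw [specialWord_of_pos hd hm, ofWord_append, mul_inv_rev, ← ih _ (by omega),
        lWord_eq_prod hd hm, lWord_eq_prod hd (by omega), List.range_succ, List.map_append,
        List.prod_append, List.map_singleton, List.prod_singleton, he, hlast, hr, hq]
    · rw [specialWord_of_lt hd hm h, lWord, if_neg (by omega), if_pos h, iterate_map_inv,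
        sigma_iterate_of_one]

theorem specialWord_prefix_succ (m : ℕ) : specialWord hd m <+: specialWord hd (m + 1) := by
  induction m using Nat.strong_induction_on with
  | _ m ih =>
    -- After the two common blocks, the indices `m - 2(d-1)` and `m + 1 - (d-1)` of the tails need
    -- not be consecutive, so the induction hypothesis is chained.
    have mono : ∀ a b, a ≤ b → b ≤ m → specialWord hd a <+: specialWord hd b := by
      intro a b hab
      induction b, hab using Nat.le_induction with
      | base => exact fun _ => List.prefix_rfl
      | succ b _ ihb => exact fun hb => (ihb (by omega)).trans (ih b (by omega))
    rcases Nat.eq_zero_or_pos m with rfl | hm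
    · rw [specialWord_zero]
      exact List.nil_prefix
    rcases Nat.lt_or_ge (d - 1) m with h | h
    · rw [specialWord_of_pos hd hm, specialWord_of_pos hd (Nat.succ_pos m),
        specialWord_of_pos hd (m := m - (d - 1)) (by omega), Nat.succ_sub_one,
        show sigmaOne hd m = sigmaOne hd (m - 1 + 1) by rw [Nat.sub_add_cancel hm],
        sigmaOne_succ_of_le hd (m - 1) (by omega), List.append_assoc,
        show m - 1 - (d - 1) = m - (d - 1) - 1 by omega]
      refine (List.prefix_append_right_inj _).2 ((List.prefix_append_right_inj _).2 ?_)
      exact mono _ _ (by omega) (by omega)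
    · rw [specialWord_of_lt hd hm h, specialWord_of_pos hd (Nat.succ_pos m)]
      exact (sigmaOne_prefix hd (by omega)).trans (List.prefix_append _ _)

theorem specialWord_prefix {m n : ℕ} (h : m ≤ n) : specialWord hd m <+: specialWord hd n := by
  induction n, h using Nat.le_induction with
  | base => exact List.prefix_rfl
  | succ n _ ih => exact ih.trans (specialWord_prefix_succ hd n)

/-- The two leading blocks `σ^{m-1}(1) σ^{m-d}(1)` merge into `σ^m(1)`. -/
theorem specialWord_eq_sigmaOne_append {m : ℕ} (hm : d ≤ m) :
    specialWord hd m = sigmaOne hd m ++ specialWord hd (m - (d - 1) - (d - 1)) := by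
  rw [specialWord_of_pos hd (by omega), specialWord_of_pos hd (m := m - (d - 1)) (by omega),
    ← List.append_assoc, show m - (d - 1) - 1 = m - 1 - (d - 1) by omega,
    ← sigmaOne_succ_of_le hd (m - 1) (by omega), Nat.sub_add_cancel (by omega)]

/-- For `m ≥ d` both words begin with `σ^m(1)`, and the tails are compared by induction. This puts
the special words in the language and lets them inherit left extensions. -/
theorem specialWord_prefix_sigmaOne (m : ℕ) : specialWord hd m <+: sigmaOne hd (m + 1) := by
  induction m using Nat.strong_induction_on with
  | _ m ih =>
    rcases Nat.eq_zero_or_pos m with rfl | hm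
    · rw [specialWord_zero]
      exact List.nil_prefix
    rcases Nat.lt_or_ge (d - 1) m with h | h
    · rw [specialWord_eq_sigmaOne_append hd (by omega), sigmaOne_succ_of_le hd m (by omega)]
      refine (List.prefix_append_right_inj _).2 ?_
      rcases Nat.eq_zero_or_pos (m - (d - 1) - (d - 1)) with h0 | h0
      · rw [h0, specialWord_zero]
        exact List.nil_prefix
      · exact (ih _ (by omega)).trans (sigmaOne_prefix hd (by omega))
    · rw [specialWord_of_lt hd hm h]
      exact sigmaOne_prefix hd (by omega)

/-! ### The words attached to the branch points -/

/-- `BranchWord hd t u`: `u⁻¹` is the word attached to a branch point that is created by the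
`t`-th application of the tree substitution to the edge of colour `2`. -/
inductive BranchWord : ℕ → List (Letter d) → Prop
  | root : BranchWord 1 []
  | step (s t : ℕ) (u : List (Letter d)) (h : BranchWord s u) (h1 : s + (d - 1) ≤ t)
      (h2 : t ≤ s + (2 * d - 2)) : BranchWord t (sigmaOne hd (t - d) ++ u)

variable {hd}

/-- A child comes at least `d - 1` steps after its parent, so nothing is created between the root
and time `d`. -/
theorem BranchWord.time {t : ℕ} {u : List (Letter d)} (h : BranchWord hd t u) :
    (t = 1 ∧ u = []) ∨ d ≤ t := by
  induction h with
  | root => exact Or.inl ⟨rfl, rfl⟩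
  | step s t u h h1 h2 ih => omega

/-- At time `t` the leading block is the same for all parents. The bound on a parent's word grows
with its time of creation, so the latest time `t - (d-1)` bounds them all. -/
theorem BranchWord.prefix {t : ℕ} {u : List (Letter d)} (h : BranchWord hd t u) :
    u <+: specialWord hd (t - (d - 1)) := by
  induction h with
  | root => exact List.nil_prefix
  | step s t u h h1 h2 ih =>
    have hs : 1 ≤ s := by
      rcases h.time with h | h <;> omega
    rw [specialWord_of_pos hd (by omega), show t - (d - 1) - 1 = t - d by omega]
    exact (List.prefix_append_right_inj _).2 (ih.trans (specialWord_prefix hd (by omega)))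

variable (hd)

theorem branchWord_specialWord {m : ℕ} (hm : 1 ≤ m) :
    BranchWord hd (m + (d - 1)) (specialWord hd m) := by
  induction m using Nat.strong_induction_on with
  | _ m ih =>
    rw [specialWord_of_pos hd hm, show m - 1 = m + (d - 1) - d by omega]
    rcases Nat.lt_or_ge (d - 1) m with h | h
    · exact .step _ _ _ (ih (m - (d - 1)) (by omega) (by omega)) (by omega) (by omega)
    · rw [Nat.sub_eq_zero_of_le h, specialWord_zero]
      exact .step _ _ _ .root (by omega) (by omega)

theorem sigmaOne_eq_specialWord_append {m : ℕ} (hm : 1 ≤ m) (hmd : m ≤ d) :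
    ∃ a, sigmaOne hd (m - 1) = specialWord hd (m - 1) ++ [a] := by
  rcases Nat.lt_or_ge m 2 with h | h
  · obtain rfl : m = 1 := by omega
    exact ⟨letterOne hd, by rw [specialWord_zero]; rfl⟩
  · obtain ⟨n, rfl⟩ := Nat.exists_eq_add_of_le' h
    rw [specialWord_of_lt hd (by omega) (by omega)]
    exact ⟨_, sigmaOne_succ_of_lt hd n hmd⟩

/-- Only a prefix longer than `specialWord (m-1)` is new. It starts with `σ^{m-1}(1)`, and the
remainder, a shorter problem, is the word of the parent. The point is that this parent is neither
too young nor too old. -/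
theorem exists_branchWord_of_prefix {m : ℕ} {v : List (Letter d)} (hv : v <+: specialWord hd m) :
    ∃ t, t ≤ m + (d - 1) ∧ BranchWord hd t v := by
  induction m using Nat.strong_induction_on generalizing v with
  | _ m ih =>
    rcases Nat.eq_zero_or_pos m with rfl | hm
    · rw [specialWord_zero, List.prefix_nil] at hv
      subst hv
      exact ⟨1, by omega, .root⟩
    by_cases hprev : v <+: specialWord hd (m - 1)
    · obtain ⟨t, ht, h⟩ := ih (m - 1) (by omega) hprev
      exact ⟨t, by omega, h⟩
    -- The child is created at time `m + (d-1)`; the parents allowed at that time have `m - (d-1) ≤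
    -- s ≤ m`.
    have key : ∀ v', v = sigmaOne hd (m - 1) ++ v' → ∀ s, BranchWord hd s v' → s ≤ m →
        m ≤ s + (d - 1) → ∃ t, t ≤ m + (d - 1) ∧ BranchWord hd t v := by
      rintro v' rfl s hs h1 h2
      refine ⟨m + (d - 1), le_rfl, ?_⟩
      have := BranchWord.step s (m + (d - 1)) v' hs (by omega) (by omega)
      rwa [show m + (d - 1) - d = m - 1 by omega] at this
    have hlen : (specialWord hd (m - 1)).length < v.length := by
      by_contra hle
      exact hprev (List.prefix_of_prefix_length_le hv (specialWord_prefix hd (by omega))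
        (by omega))
    rcases Nat.lt_or_ge m (d + 1) with h | h
    -- For `m ≤ d`, `σ^{m-1}(1)` has just one letter more than `specialWord (m-1)`. The new prefixes
    -- are this word and, when `m = d`, also `σ^{d-1}(1)1`.
    · by_cases hx : v <+: sigmaOne hd (m - 1)
      · obtain ⟨a, ha⟩ := sigmaOne_eq_specialWord_append hd hm (by omega)
        rw [ha, List.prefix_concat_iff] at hx
        refine key [] ?_ 1 .root (by omega) (by omega)
        rw [List.append_nil, ha]
        exact hx.resolve_right hprev
      · rcases Nat.lt_or_ge m d with hmd | hmd
        · rw [specialWord_of_lt hd hm (by omega)] at hv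
          exact absurd hv hx
        · refine ⟨m + (d - 1), le_rfl, ?_⟩
          have hmd' : m - (d - 1) = 1 := by omega
          have heq : specialWord hd m = sigmaOne hd (m - 1) ++ [letterOne hd] := by
            rw [specialWord_of_pos hd hm, hmd', specialWord_of_lt hd le_rfl (by omega)]
            rfl
          rw [heq, List.prefix_concat_iff] at hv
          rw [hv.resolve_right hx, ← heq]
          exact branchWord_specialWord hd hm
    · have hpre : sigmaOne hd (m - 1) <+: specialWord hd (m - 1) := by
        rw [specialWord_eq_sigmaOne_append hd (by omega)]
        exact List.prefix_append _ _
      have hpl := hpre.length_le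
      rw [specialWord_of_pos hd hm] at hv
      obtain ⟨v', rfl⟩ := List.prefix_of_prefix_length_le (List.prefix_append _ _) hv
        (by omega)
      have hv' := (List.prefix_append_right_inj _).1 hv
      obtain ⟨s, hs, hb⟩ := ih (m - (d - 1)) (by omega) hv'
      refine key v' rfl s hb (by omega) ?_
      -- A parent that is too old has so short a word that `v` would not be longer than `specialWord
      -- (m-1)`.
      by_contra hsm
      have h3 := (hb.prefix.trans
        (specialWord_prefix hd (n := m - 1 - (d - 1) - (d - 1)) (by omega))).length_le
      rw [specialWord_eq_sigmaOne_append hd (m := m - 1) (by omega)] at hlen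
      simp only [List.length_append] at hlen
      omega

/-! ### Bispeciality -/

variable {hd} in
theorem language_of_infix {u v : List (Letter d)} (hv : v ∈ language hd) (h : u <:+: v) :
    u ∈ language hd := by
  obtain ⟨n, a, hn⟩ := hv
  exact ⟨n, a, h.trans hn⟩

variable {hd} in
theorem language_sigmaWord {u : List (Letter d)} (hu : u ∈ language hd) :
    sigmaWord hd u ∈ language hd := by
  obtain ⟨n, a, s, t, h⟩ := hu
  refine ⟨n + 1, a, sigmaWord hd s, sigmaWord hd t, ?_⟩
  rw [Function.iterate_succ_apply', ← h, sigmaWord_append, sigmaWord_append]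

variable {hd} in
theorem language_sigmaWord_iterate {u : List (Letter d)} (hu : u ∈ language hd) (n : ℕ) :
    (sigmaWord hd)^[n] u ∈ language hd := by
  induction n with
  | zero => exact hu
  | succ n ih =>
    rw [Function.iterate_succ_apply']
    exact language_sigmaWord ih

theorem sigmaOne_mem_language (n : ℕ) : sigmaOne hd n ∈ language hd :=
  ⟨n, letterOne hd, List.infix_rfl⟩

/-- The last letter of `σ(a)`. -/
def lastLetter (a : Letter d) : Letter d :=
  if h : a.1 + 1 ≤ d then ⟨a.1 + 1, by omega, h⟩ else letterOne hd

theorem lastLetter_injective : Function.Injective (lastLetter hd) := by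
  intro a b h
  have ha := a.2
  have hb := b.2
  have h' := congrArg Subtype.val h
  apply Subtype.ext
  rw [lastLetter, lastLetter] at h'
  split_ifs at h' <;> simp only [letterOne] at h' <;> omega

theorem sigmaLetter_eq_append (a : Letter d) : ∃ s, sigmaLetter hd a = s ++ [lastLetter hd a] := by
  obtain ⟨a, ha⟩ := a
  rw [sigmaLetter, lastLetter]
  split_ifs with h1 h2 h2
  · simp only at h1
    subst h1
    exact ⟨[⟨1, ha⟩], rfl⟩
  · simp only at h1 h2
    omega
  · exact ⟨[], rfl⟩
  · exact ⟨[], rfl⟩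

/-- The word `d112` belongs to the language. -/
theorem infix_sigmaOne :
    [⟨d, by omega, le_rfl⟩, letterOne hd, letterOne hd, ⟨2, by omega, by omega⟩]
      <:+: sigmaOne hd (d + 1) := by
  -- Here `σ^{d+1}(1) = σ^d(1) σ(1) = (12⋯d1)(12)`, which ends with `d112`.
  rw [sigmaOne_succ_of_le hd d (by omega), show d - (d - 1) = 1 by omega, sigmaOne_one]
  obtain ⟨n, rfl⟩ : ∃ n, d = n + 2 := ⟨d - 2, by omega⟩
  rw [sigmaOne_succ_of_le hd (n + 1) (by omega), show n + 1 - (n + 2 - 1) = 0 by omega,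
    sigmaOne_zero, sigmaOne_succ_of_lt hd n le_rfl]
  refine ⟨sigmaOne hd n, [], ?_⟩
  simp [Nat.add_comm]

/-- The factor `d112` shows that `1` extends to the left by `1` and `d`. Applying `σ` keeps two left
extensions distinct because the last letter of `σ(a)` determines `a`. -/
theorem left_special_sigmaOne (n : ℕ) :
    ∃ a b : Letter d, a ≠ b ∧ a :: sigmaOne hd n ∈ language hd ∧
      b :: sigmaOne hd n ∈ language hd := by
  induction n with
  | zero =>
    refine ⟨letterOne hd, ⟨d, by omega, le_rfl⟩, ?_, ?_, ?_⟩
    · rw [letterOne, Ne, Subtype.mk.injEq]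
      omega
    · exact language_of_infix (sigmaOne_mem_language hd (d + 1))
        (List.IsInfix.trans ⟨[_], [_], rfl⟩ (infix_sigmaOne hd))
    · exact language_of_infix (sigmaOne_mem_language hd (d + 1))
        (List.IsInfix.trans ⟨[], [_, _], rfl⟩ (infix_sigmaOne hd))
  | succ n ih =>
    obtain ⟨a, b, hab, ha, hb⟩ := ih
    have key : ∀ c : Letter d, c :: sigmaOne hd n ∈ language hd →
        lastLetter hd c :: sigmaOne hd (n + 1) ∈ language hd := by
      intro c hc
      obtain ⟨s, hs⟩ := sigmaLetter_eq_append hd c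
      refine language_of_infix (language_sigmaWord hc) ⟨s, [], ?_⟩
      rw [← List.singleton_append (l := sigmaOne hd n), sigmaWord_append, sigmaWord_singleton, hs,
        show sigmaWord hd (sigmaOne hd n) = sigmaOne hd (n + 1) from
          sigmaWord_iterate_sigmaOne hd 1 n]
      simp
    exact ⟨_, _, (lastLetter_injective hd).ne hab, key a ha, key b hb⟩

theorem specialWord_add_mul (q s : ℕ) (hs : s ≤ d - 2) :
    specialWord hd (1 + q * (d - 1) + s)
      = (sigmaWord hd)^[s] (specialWord hd (1 + q * (d - 1))) := by
  induction q with
  | zero =>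
    rw [specialWord_of_lt hd (by omega) (by omega), specialWord_of_lt hd (by omega) (by omega),
      sigmaWord_iterate_sigmaOne]
    congr 1
    omega
  | succ q ih =>
    rw [specialWord_of_pos hd (by omega), specialWord_of_pos hd (m := 1 + (q + 1) * (d - 1))
      (by omega), sigmaWord_iterate_append, sigmaWord_iterate_sigmaOne, Nat.add_mul, Nat.one_mul,
      show 1 + (q * (d - 1) + (d - 1)) + s - (d - 1) = 1 + q * (d - 1) + s by omega, ih,
      show 1 + (q * (d - 1) + (d - 1)) - (d - 1) = 1 + q * (d - 1) by omega]
    congr 2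
    omega

/-- Applying `σ^{d-1}` shifts the exponent of every block by `d - 1`; what is missing is the new
final block `σ^0(1) = 1`. -/
theorem specialWord_mul_succ (q : ℕ) :
    specialWord hd (1 + (q + 1) * (d - 1))
      = (sigmaWord hd)^[d - 1] (specialWord hd (1 + q * (d - 1))) ++ [letterOne hd] := by
  induction q with
  | zero =>
    rw [specialWord_of_pos hd (by omega), specialWord_of_lt hd (m := 1 + 0 * (d - 1)) (by omega)
      (by omega), show 1 + (0 + 1) * (d - 1) - (d - 1) = 1 by omega,
      specialWord_of_lt hd le_rfl (by omega), sigmaWord_iterate_sigmaOne]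
    congr 2
    omega
  | succ q ih =>
    rw [specialWord_of_pos hd (by omega), specialWord_of_pos hd (m := 1 + (q + 1) * (d - 1))
      (by omega), sigmaWord_iterate_append, sigmaWord_iterate_sigmaOne, List.append_assoc,
      show 1 + (q + 1 + 1) * (d - 1) - (d - 1) = 1 + (q + 1) * (d - 1) by
        rw [Nat.add_mul (q + 1)]; omega, ih,
      show 1 + (q + 1) * (d - 1) - (d - 1) = 1 + q * (d - 1) by
        rw [Nat.add_mul]; omega]
    congr 2
    rw [Nat.add_mul (q + 1)]
    omega

/-- Two letters of extension are carried because `σ^{d-1}(1)` and `σ^{d-1}(2) = 1` both begin with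
`1`. That common `1` is absorbed by the next special word. What follows it is `σ^{d-1}(3) = 12` in
one case, and `23` in the other since `σ^d(1)` begins with `123`. The two extensions thus exchange
roles. -/
theorem right_special_aux (q : ℕ) :
    specialWord hd (1 + q * (d - 1)) ++ [letterOne hd, ⟨2, by omega, by omega⟩] ∈ language hd ∧
    specialWord hd (1 + q * (d - 1)) ++ [⟨2, by omega, by omega⟩, ⟨3, by omega, hd⟩]
      ∈ language hd := by
  have h2 : sigmaOne hd 2 = [letterOne hd, ⟨2, by omega, by omega⟩, ⟨3, by omega, hd⟩] := by
    rw [sigmaOne_succ_of_lt hd 1 (by omega), sigmaOne_one]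
    rfl
  induction q with
  | zero =>
    rw [specialWord_of_lt hd (by omega) (by omega), show 1 + 0 * (d - 1) - 1 = 0 by omega,
      sigmaOne_zero]
    refine ⟨language_of_infix (sigmaOne_mem_language hd (d + 1))
        (List.IsInfix.trans ⟨[_], [], rfl⟩ (infix_sigmaOne hd)), ?_⟩
    have := sigmaOne_mem_language hd 2
    rwa [h2] at this
  | succ q ih =>
    obtain ⟨hA, hB⟩ := ih
    rw [specialWord_mul_succ]
    constructor
    · have h := language_sigmaWord_iterate hB (d - 1)
      have h3 : (sigmaWord hd)^[d - 1] [(⟨3, by omega, hd⟩ : Letter d)]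
          = [letterOne hd, ⟨2, by omega, by omega⟩] := by
        rw [show d - 1 = (d - 3 + 1) + 1 by omega, Function.iterate_succ_apply',
          sigmaWord_iterate_letter_wrap hd 3 (by omega) hd, ← sigmaOne_one]
        rfl
      have h2 : (sigmaWord hd)^[d - 1] [(⟨2, by omega, by omega⟩ : Letter d)]
          = [letterOne hd] := by
        rw [show d - 1 = d - 2 + 1 by omega]
        exact sigmaWord_iterate_letter_wrap hd 2 le_rfl (by omega)
      rw [← List.singleton_append (l := [_]), sigmaWord_iterate_append,
        sigmaWord_iterate_append, h3, h2] at h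
      rwa [List.append_assoc]
    · have h := language_sigmaWord_iterate hA (d - 1)
      rw [sigmaWord_iterate_append, ← sigmaOne_one, sigmaWord_iterate_sigmaOne] at h
      refine language_of_infix h (List.IsPrefix.isInfix ?_)
      rw [List.append_assoc]
      refine (List.prefix_append_right_inj _).2 ?_
      have := sigmaOne_prefix hd (m := 2) (n := 1 + (d - 1)) (by omega)
      rwa [h2] at this

theorem isBispecial_specialWord {m : ℕ} (hm : 1 ≤ m) : IsBispecial hd (specialWord hd m) := by
  have hpre := specialWord_prefix_sigmaOne hd m
  refine ⟨language_of_infix (sigmaOne_mem_language hd (m + 1)) hpre.isInfix, ?_, ?_⟩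
  · obtain ⟨a, b, hab, ha, hb⟩ := left_special_sigmaOne hd (m + 1)
    exact ⟨a, b, hab, language_of_infix ha ((List.prefix_cons_inj a).2 hpre).isInfix,
      language_of_infix hb ((List.prefix_cons_inj b).2 hpre).isInfix⟩
  -- Applying `σ^s` to the extensions at index `1 + q(d-1)` keeps them apart: one begins with `1`,
  -- the other with `σ^s(2) = 2 + s`.
  · obtain ⟨q, s, hs, rfl⟩ : ∃ q s, s ≤ d - 2 ∧ m = 1 + q * (d - 1) + s := by
      refine ⟨(m - 1) / (d - 1), (m - 1) % (d - 1), ?_, ?_⟩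
      · have := Nat.mod_lt (m - 1) (y := d - 1) (by omega)
        omega
      · have := Nat.mod_add_div (m - 1) (d - 1)
        rw [Nat.mul_comm] at this
        omega
    obtain ⟨hA, hB⟩ := right_special_aux hd q
    have hA' := language_sigmaWord_iterate hA s
    have hB' := language_sigmaWord_iterate hB s
    rw [← List.singleton_append (l := [_]), sigmaWord_iterate_append,
      sigmaWord_iterate_append] at hA' hB'
    rw [sigmaWord_iterate_letter hd s 2 le_rfl (by omega)] at hB'
    rw [specialWord_add_mul hd q s hs]
    refine ⟨letterOne hd, ⟨2 + s, by omega, by omega⟩, ?_, ?_, ?_⟩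
    · rw [letterOne, Ne, Subtype.mk.injEq]
      omega
    · refine language_of_infix hA' (List.IsPrefix.isInfix ?_)
      refine (List.prefix_append_right_inj _).2 ?_
      exact (sigmaOne_prefix hd (Nat.zero_le s)).trans (List.prefix_append _ _)
    · refine language_of_infix hB' (List.IsPrefix.isInfix ?_)
      exact (List.prefix_append_right_inj _).2 (List.prefix_append _ _)

end

/-! ### One application of the tree substitution -/

section

variable {d : ℕ} (hd : 3 ≤ d)

/-- The colour of the image of an edge of colour `c ≠ 2`. -/
def nextColour (c : Colour d) : Colour d :=
  if h1 : c.1 = 1 then ⟨d, by omega⟩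
  else if c.1 = d + 1 then ⟨1, by omega⟩
  else ⟨c.1 - 1, by have := c.2; omega⟩

theorem tauEdge_of_ne {e : Vertex × Vertex × Colour d} (h : e.2.2.1 ≠ 2) :
    tauEdge hd e = singleEdge e.1 e.2.1 (nextColour hd e.2.2) := by
  rw [tauEdge, nextColour]
  split_ifs <;> rfl

theorem tauEdge_of_eq {e : Vertex × Vertex × Colour d} (h : e.2.2.1 = 2) :
    tauEdge hd e = imageTwo hd e.1 e.2.1 := by
  rw [tauEdge, dif_neg (by omega), if_pos h]

theorem mem_tau_edges {X : ColouredGraph Vertex (Colour d)} {e : Vertex × Vertex × Colour d} :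
    e ∈ (tau hd X).edges ↔
      (∃ x y c, (x, y, c) ∈ X.edges ∧ c.1 ≠ 2 ∧ e = (x, y, nextColour hd c)) ∨
      ∃ x y c, (x, y, c) ∈ X.edges ∧ c.1 = 2 ∧ e ∈ (imageTwo hd x y).edges := by
  rw [tau, Set.mem_iUnion₂]
  constructor
  · rintro ⟨⟨x, y, c⟩, hf, he⟩
    by_cases h : c.1 = 2
    · rw [tauEdge_of_eq hd h] at he
      exact Or.inr ⟨x, y, c, hf, h, he⟩
    · rw [tauEdge_of_ne hd h] at he
      exact Or.inl ⟨x, y, c, hf, h, he⟩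
  · rintro (⟨x, y, c, hf, h, rfl⟩ | ⟨x, y, c, hf, h, he⟩)
    · refine ⟨(x, y, c), hf, ?_⟩
      rw [tauEdge_of_ne hd h]
      rfl
    · refine ⟨(x, y, c), hf, ?_⟩
      rwa [tauEdge_of_eq hd h]

theorem mem_imageTwo_edges {x y : Vertex} {e : Vertex × Vertex × Colour d} :
    e ∈ (imageTwo hd x y).edges ↔
      e = (.centre x y, x, ⟨d, by omega⟩) ∨ e = (.centre x y, y, ⟨1, by omega⟩) ∨
      ∃ (h : ℕ) (h1 : 1 ≤ h) (h2 : h ≤ d - 2),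
        e = (.centre x y, .leaf x y h, ⟨d + h, by omega⟩) :=
  or_assoc

/-- The invariants of the graphs obtained by iterating the tree substitution. -/
structure Admissible (X : ColouredGraph Vertex (Colour d)) : Prop where
  source_mem : ∀ {x y c}, (x, y, c) ∈ X.edges → x ∈ X.verts
  target_mem : ∀ {x y c}, (x, y, c) ∈ X.edges → y ∈ X.verts
  exists_edge : ∀ {v}, v ∈ X.verts → ∃ e ∈ X.edges, v = e.1 ∨ v = e.2.1
  mem_of_centre : ∀ {x y}, .centre x y ∈ X.verts → x ∈ X.verts
  mem_of_leaf : ∀ {x y h}, .leaf x y h ∈ X.verts → x ∈ X.verts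
  centre_notMem : ∀ {x y c}, (x, y, c) ∈ X.edges → .centre x y ∉ X.verts
  leaf_notMem : ∀ {x y c} (h : ℕ), (x, y, c) ∈ X.edges → .leaf x y h ∉ X.verts
  colour_unique : ∀ {x y c c'}, (x, y, c) ∈ X.edges → (x, y, c') ∈ X.edges → c = c'
  ne : ∀ {x y c}, (x, y, c) ∈ X.edges → x ≠ y

variable {hd}
variable {X : ColouredGraph Vertex (Colour d)}

theorem Admissible.mem_tau_verts (hX : Admissible X) {v : Vertex} :
    v ∈ (tau hd X).verts ↔ v ∈ X.verts ∨ ∃ x y c, (x, y, c) ∈ X.edges ∧ c.1 = 2 ∧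
      (v = .centre x y ∨ ∃ h, 1 ≤ h ∧ h ≤ d - 2 ∧ v = .leaf x y h) := by
  rw [tau, Set.mem_iUnion₂]
  constructor
  · rintro ⟨⟨x, y, c⟩, hf, hv⟩
    by_cases h : c.1 = 2
    · rw [tauEdge_of_eq hd h] at hv
      rcases hv with (rfl | rfl | rfl) | hv
      · exact Or.inl (hX.source_mem hf)
      · exact Or.inl (hX.target_mem hf)
      · exact Or.inr ⟨x, y, c, hf, h, Or.inl rfl⟩
      · exact Or.inr ⟨x, y, c, hf, h, Or.inr hv⟩
    · rw [tauEdge_of_ne hd h] at hv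
      rcases hv with rfl | rfl
      · exact Or.inl (hX.source_mem hf)
      · exact Or.inl (hX.target_mem hf)
  · rintro (hv | ⟨x, y, c, hf, h, hv⟩)
    · obtain ⟨⟨x, y, c⟩, hf, hv⟩ := hX.exists_edge hv
      refine ⟨(x, y, c), hf, ?_⟩
      by_cases h : c.1 = 2
      · rw [tauEdge_of_eq hd h]
        rcases hv with rfl | rfl
        · exact Or.inl (Or.inl rfl)
        · exact Or.inl (Or.inr (Or.inl rfl))
      · rw [tauEdge_of_ne hd h]
        exact hv
    · refine ⟨(x, y, c), hf, ?_⟩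
      rw [tauEdge_of_eq hd h]
      rcases hv with rfl | hv
      · exact Or.inl (Or.inr (Or.inr rfl))
      · exact Or.inr hv

theorem Admissible.centre_mem_tau (hX : Admissible X) {x y : Vertex}
    (h : .centre x y ∈ (tau hd X).verts) :
    .centre x y ∈ X.verts ∨ ∃ c, (x, y, c) ∈ X.edges ∧ c.1 = 2 := by
  rcases hX.mem_tau_verts.1 h with h | ⟨x', y', c, hf, hc, h | ⟨_, _, _, h⟩⟩
  · exact Or.inl h
  · cases h
    exact Or.inr ⟨c, hf, hc⟩
  · cases h

theorem Admissible.leaf_mem_tau (hX : Admissible X) {x y : Vertex} {h : ℕ}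
    (hv : .leaf x y h ∈ (tau hd X).verts) :
    .leaf x y h ∈ X.verts ∨ ∃ c, (x, y, c) ∈ X.edges ∧ c.1 = 2 := by
  rcases hX.mem_tau_verts.1 hv with hv | ⟨x', y', c, hf, hc, hv | ⟨_, _, _, hv⟩⟩
  · exact Or.inl hv
  · cases hv
  · cases hv
    exact Or.inr ⟨c, hf, hc⟩

/-- The point is that names stay fresh. A name records the ends of an edge but not its colour, hence
`colour_unique`. For an edge leaving a new centre, a name already in use would force that centre to
be an old vertex, by `mem_of_centre`, `mem_of_leaf` or `source_mem`. -/
theorem Admissible.tau (hX : Admissible X) : Admissible (tau hd X) := by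
  have hold : ∀ {v}, v ∈ X.verts → v ∈ (TreeSub.tau hd X).verts :=
    fun h => hX.mem_tau_verts.2 (Or.inl h)
  have hnewc : ∀ {x y c}, (x, y, c) ∈ X.edges → c.1 = 2 →
      .centre x y ∈ (TreeSub.tau hd X).verts :=
    fun h h2 => hX.mem_tau_verts.2 (Or.inr ⟨_, _, _, h, h2, Or.inl rfl⟩)
  have hsrc : ∀ {x y} {e : Vertex × Vertex × Colour d}, e ∈ (imageTwo hd x y).edges →
      e.1 = .centre x y := by
    intro x y e he
    rcases (mem_imageTwo_edges hd).1 he with rfl | rfl | ⟨_, _, _, rfl⟩ <;> rfl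
  constructor
  · intro x y c h
    rcases (mem_tau_edges hd).1 h with ⟨x', y', c', hf, hc, he⟩ | ⟨x', y', c', hf, hc, he⟩
    · cases he
      exact hold (hX.source_mem hf)
    · obtain rfl : x = _ := hsrc he
      exact hnewc hf hc
  · intro x y c h
    rcases (mem_tau_edges hd).1 h with ⟨x', y', c', hf, hc, he⟩ | ⟨x', y', c', hf, hc, he⟩
    · cases he
      exact hold (hX.target_mem hf)
    · rcases (mem_imageTwo_edges hd).1 he with he | he | ⟨k, h1, h2, he⟩ <;> cases he
      · exact hold (hX.source_mem hf)
      · exact hold (hX.target_mem hf)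
      · exact hX.mem_tau_verts.2 (Or.inr ⟨_, _, _, hf, hc, Or.inr ⟨k, h1, h2, rfl⟩⟩)
  · intro v hv
    rw [TreeSub.tau, Set.mem_iUnion₂] at hv
    obtain ⟨⟨x, y, c⟩, hf, hv⟩ := hv
    by_cases h : c.1 = 2
    · rw [tauEdge_of_eq hd h] at hv
      have key : ∀ e ∈ (imageTwo hd x y).edges, e ∈ (TreeSub.tau hd X).edges :=
        fun e he => (mem_tau_edges hd).2 (Or.inr ⟨x, y, c, hf, h, he⟩)
      rcases hv with (rfl | rfl | rfl) | ⟨k, h1, h2, rfl⟩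
      · exact ⟨_, key _ (Or.inl (Or.inl rfl)), Or.inr rfl⟩
      · exact ⟨_, key _ (Or.inl (Or.inr rfl)), Or.inr rfl⟩
      · exact ⟨_, key _ (Or.inl (Or.inr rfl)), Or.inl rfl⟩
      · exact ⟨_, key _ (Or.inr ⟨k, h1, h2, rfl⟩), Or.inr rfl⟩
    · rw [tauEdge_of_ne hd h] at hv
      exact ⟨_, (mem_tau_edges hd).2 (Or.inl ⟨x, y, c, hf, h, rfl⟩), hv⟩
  · intro x y h
    rcases hX.centre_mem_tau h with h | ⟨c, h, -⟩
    · exact hold (hX.mem_of_centre h)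
    · exact hold (hX.source_mem h)
  · intro x y k h
    rcases hX.leaf_mem_tau h with h | ⟨c, h, -⟩
    · exact hold (hX.mem_of_leaf h)
    · exact hold (hX.source_mem h)
  · intro x y c h hv
    rcases (mem_tau_edges hd).1 h with ⟨x', y', c', hf, hc, he⟩ | ⟨x', y', c', hf, hc, he⟩
    · cases he
      rcases hX.centre_mem_tau hv with hv | ⟨c2, hv, hc2⟩
      · exact hX.centre_notMem hf hv
      · exact hc (hX.colour_unique hv hf ▸ hc2)
    · obtain rfl : x = _ := hsrc he
      rcases hX.centre_mem_tau hv with hv | ⟨c2, hv, -⟩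
      · exact hX.centre_notMem hf (hX.mem_of_centre hv)
      · exact hX.centre_notMem hf (hX.source_mem hv)
  · intro x y c k h hv
    rcases (mem_tau_edges hd).1 h with ⟨x', y', c', hf, hc, he⟩ | ⟨x', y', c', hf, hc, he⟩
    · cases he
      rcases hX.leaf_mem_tau hv with hv | ⟨c2, hv, hc2⟩
      · exact hX.leaf_notMem k hf hv
      · exact hc (hX.colour_unique hv hf ▸ hc2)
    · obtain rfl : x = _ := hsrc he
      rcases hX.leaf_mem_tau hv with hv | ⟨c2, hv, -⟩
      · exact hX.centre_notMem hf (hX.mem_of_leaf hv)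
      · exact hX.centre_notMem hf (hX.source_mem hv)
  · intro x y c1 c2 h1 h2
    rcases (mem_tau_edges hd).1 h1 with ⟨x', y', c', hf, hc, he⟩ | ⟨x', y', c', hf, hc, he⟩ <;>
    rcases (mem_tau_edges hd).1 h2 with
      ⟨x2, y2, c2', hf2, hc2, he2⟩ | ⟨x2, y2, c2', hf2, hc2, he2⟩
    · cases he
      cases he2
      rw [hX.colour_unique hf hf2]
    · cases he
      obtain rfl : x = _ := hsrc he2
      exact absurd (hX.source_mem hf) (hX.centre_notMem hf2)
    · cases he2
      obtain rfl : x = _ := hsrc he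
      exact absurd (hX.source_mem hf2) (hX.centre_notMem hf)
    · obtain rfl : x = _ := hsrc he
      cases hsrc he2
      have hn := hX.ne hf
      rcases (mem_imageTwo_edges hd).1 he with he | he | ⟨k, k1, k2, he⟩ <;>
      rcases (mem_imageTwo_edges hd).1 he2 with he2 | he2 | ⟨k', k1', k2', he2⟩ <;>
      simp only [Prod.mk.injEq, true_and] at he he2
      · exact he.2.trans he2.2.symm
      · exact absurd (he.1.symm.trans he2.1) hn
      · exact absurd (hX.source_mem hf) (he.1.symm.trans he2.1 ▸ hX.leaf_notMem k' hf)
      · exact absurd (he2.1.symm.trans he.1) hn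
      · exact he.2.trans he2.2.symm
      · exact absurd (hX.target_mem hf) (he.1.symm.trans he2.1 ▸ hX.leaf_notMem k' hf)
      · exact absurd (hX.source_mem hf) (he2.1.symm.trans he.1 ▸ hX.leaf_notMem k hf)
      · exact absurd (hX.target_mem hf) (he2.1.symm.trans he.1 ▸ hX.leaf_notMem k hf)
      · have := he.1.symm.trans he2.1
        cases this
        exact he.2.trans he2.2.symm
  · intro x y c h hxy
    subst hxy
    rcases (mem_tau_edges hd).1 h with ⟨x', y', c', hf, hc, he⟩ | ⟨x', y', c', hf, hc, he⟩
    · cases he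
      exact hX.ne hf rfl
    · obtain rfl : x = _ := hsrc he
      rcases (mem_imageTwo_edges hd).1 he with he | he | ⟨k, h1, h2, he⟩ <;>
      simp only [Prod.mk.injEq, true_and] at he
      · exact absurd (hX.source_mem hf) (he.1 ▸ hX.centre_notMem hf)
      · exact absurd (hX.target_mem hf) (he.1 ▸ hX.centre_notMem hf)
      · cases he.1

theorem Admissible.source_ne_centre (hX : Admissible X) {x y x' y' : Vertex} {c c' : Colour d}
    (hf' : (x', y', c') ∈ X.edges) (hf : (x, y, c) ∈ X.edges) : x' ≠ .centre x y :=
  ne_of_mem_of_not_mem (hX.source_mem hf') (hX.centre_notMem hf)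

theorem Admissible.target_ne_centre (hX : Admissible X) {x y x' y' : Vertex} {c c' : Colour d}
    (hf' : (x', y', c') ∈ X.edges) (hf : (x, y, c) ∈ X.edges) : y' ≠ .centre x y :=
  ne_of_mem_of_not_mem (hX.target_mem hf') (hX.centre_notMem hf)

theorem Admissible.source_ne_leaf (hX : Admissible X) {x y x' y' : Vertex} {c c' : Colour d}
    {k : ℕ} (hf' : (x', y', c') ∈ X.edges) (hf : (x, y, c) ∈ X.edges) : x' ≠ .leaf x y k :=
  ne_of_mem_of_not_mem (hX.source_mem hf') (hX.leaf_notMem k hf)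

theorem Admissible.target_ne_leaf (hX : Admissible X) {x y x' y' : Vertex} {c c' : Colour d}
    {k : ℕ} (hf' : (x', y', c') ∈ X.edges) (hf : (x, y, c) ∈ X.edges) : y' ≠ .leaf x y k :=
  ne_of_mem_of_not_mem (hX.target_mem hf') (hX.leaf_notMem k hf)

/-! ### Degrees -/

variable (hd) in
open Classical in
/-- The edge of the image of `e` that contains the end `v` of `e`. -/
noncomputable def imageAt (v : Vertex) (e : Vertex × Vertex × Colour d) :
    Vertex × Vertex × Colour d :=
  if e.2.2.1 = 2 then
    if v = e.1 then (.centre e.1 e.2.1, e.1, ⟨d, by omega⟩)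
    else (.centre e.1 e.2.1, e.2.1, ⟨1, by omega⟩)
  else (e.1, e.2.1, nextColour hd e.2.2)

/-- At an old vertex each incident edge is replaced by exactly one incident edge. The name of a
centre recovers the edge that it subdivides, which gives injectivity. -/
theorem Admissible.degree_tau (hX : Admissible X) {v : Vertex} (hv : v ∈ X.verts) :
    degree (TreeSub.tau hd X) v = degree X v := by
  have himage : {e ∈ (TreeSub.tau hd X).edges | e.1 = v ∨ e.2.1 = v}
      = imageAt hd v '' {e ∈ X.edges | e.1 = v ∨ e.2.1 = v} := by
    ext e
    constructor
    · rintro ⟨he, hev⟩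
      rcases (mem_tau_edges hd).1 he with ⟨x, y, c, hf, hc, rfl⟩ | ⟨x, y, c, hf, hc, he⟩
      · exact ⟨(x, y, c), ⟨hf, hev⟩, by rw [imageAt, if_neg hc]⟩
      · rcases (mem_imageTwo_edges hd).1 he with rfl | rfl | ⟨k, h1, h2, rfl⟩
        · obtain rfl : x = v :=
            hev.resolve_left fun h => ne_of_mem_of_not_mem hv (hX.centre_notMem hf) h.symm
          exact ⟨(x, y, c), ⟨hf, Or.inl rfl⟩, by rw [imageAt, if_pos hc, if_pos rfl]⟩
        · obtain rfl : y = v :=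
            hev.resolve_left fun h => ne_of_mem_of_not_mem hv (hX.centre_notMem hf) h.symm
          exact ⟨(x, y, c), ⟨hf, Or.inr rfl⟩,
            by rw [imageAt, if_pos hc, if_neg (hX.ne hf).symm]⟩
        · rcases hev with h | h
          · exact absurd hv (h ▸ hX.centre_notMem hf)
          · exact absurd hv (h ▸ hX.leaf_notMem k hf)
    · rintro ⟨⟨x, y, c⟩, ⟨hf, hev⟩, rfl⟩
      rw [imageAt]
      split_ifs with hc h1
      · exact ⟨(mem_tau_edges hd).2 (Or.inr ⟨x, y, c, hf, hc, Or.inl (Or.inl rfl)⟩),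
          Or.inr h1.symm⟩
      · exact ⟨(mem_tau_edges hd).2 (Or.inr ⟨x, y, c, hf, hc, Or.inl (Or.inr rfl)⟩),
          Or.inr (hev.resolve_left fun h => h1 h.symm)⟩
      · exact ⟨(mem_tau_edges hd).2 (Or.inl ⟨x, y, c, hf, hc, rfl⟩), hev⟩
  rw [degree, degree, himage]
  apply Set.InjOn.ncard_image
  rintro ⟨x, y, c⟩ ⟨hf, hev⟩ ⟨x', y', c'⟩ ⟨hf', hev'⟩ h
  have hx : x ∈ X.verts := hX.source_mem hf
  have hx' : x' ∈ X.verts := hX.source_mem hf'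
  rw [imageAt, imageAt] at h
  have same : Vertex.centre x y = .centre x' y' → ((x, y, c) : _ × _ × _) = (x', y', c') := by
    intro h
    cases h
    rw [hX.colour_unique hf hf']
  split_ifs at h <;> simp only [Prod.mk.injEq] at h
  · exact same h.1
  · exact same h.1
  · exact absurd hx' (h.1 ▸ hX.centre_notMem hf)
  · exact same h.1
  · exact same h.1
  · exact absurd hx' (h.1 ▸ hX.centre_notMem hf)
  · exact absurd hx (h.1 ▸ hX.centre_notMem hf')
  · exact absurd hx (h.1 ▸ hX.centre_notMem hf')
  · obtain ⟨rfl, rfl, -⟩ := h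
    rw [hX.colour_unique hf hf']

theorem Admissible.degree_centre (hX : Admissible X) {x y : Vertex} {c : Colour d}
    (hf : (x, y, c) ∈ X.edges) (hc : c.1 = 2) :
    degree (TreeSub.tau hd X) (.centre x y) = d := by
  have hset : {e ∈ (TreeSub.tau hd X).edges | e.1 = .centre x y ∨ e.2.1 = .centre x y}
      = (imageTwo hd x y).edges := by
    ext e
    constructor
    · rintro ⟨he, hev⟩
      rcases (mem_tau_edges hd).1 he with ⟨x', y', c', hf', hc', rfl⟩ | ⟨x', y', c', hf', hc', he⟩
      · rcases hev with h | h
        · exact absurd h (hX.source_ne_centre hf' hf)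
        · exact absurd h (hX.target_ne_centre hf' hf)
      · have h1 : e.1 = .centre x y := by
          refine hev.resolve_right fun h => ?_
          rcases (mem_imageTwo_edges hd).1 he with rfl | rfl | ⟨k, h1, h2, rfl⟩
          · exact absurd h (hX.source_ne_centre hf' hf)
          · exact absurd h (hX.target_ne_centre hf' hf)
          · cases h
        have h2 : e.1 = .centre x' y' := by
          rcases (mem_imageTwo_edges hd).1 he with rfl | rfl | ⟨_, _, _, rfl⟩ <;> rfl
        cases h1.symm.trans h2
        exact he
    · intro he
      refine ⟨(mem_tau_edges hd).2 (Or.inr ⟨x, y, c, hf, hc, he⟩), Or.inl ?_⟩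
      rcases (mem_imageTwo_edges hd).1 he with rfl | rfl | ⟨_, _, _, rfl⟩ <;> rfl
  -- The `d` edges at a new centre have distinct colours, so counting the colours counts the edges.
  have hcolours : (fun e : Vertex × Vertex × Colour d => e.2.2.1) '' (imageTwo hd x y).edges
      = (insert 1 (Finset.Icc d (2 * d - 2)) : Finset ℕ) := by
    ext k
    rw [Finset.mem_coe, Finset.mem_insert, Finset.mem_Icc]
    constructor
    · rintro ⟨e, he, rfl⟩
      rcases (mem_imageTwo_edges hd).1 he with rfl | rfl | ⟨k, h1, h2, rfl⟩
      · exact Or.inr ⟨le_rfl, show d ≤ 2 * d - 2 by omega⟩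
      · exact Or.inl rfl
      · exact Or.inr ⟨Nat.le_add_right d k, show d + k ≤ 2 * d - 2 by omega⟩
    · intro h
      by_cases h1 : k = 1
      · exact ⟨_, Or.inl (Or.inr rfl), h1.symm⟩
      · by_cases h2 : k = d
        · exact ⟨_, Or.inl (Or.inl rfl), h2.symm⟩
        · refine ⟨_, Or.inr ⟨k - d, by omega, by omega, rfl⟩, ?_⟩
          simp only
          omega
  rw [degree, hset, ← Set.InjOn.ncard_image
    (f := fun e : Vertex × Vertex × Colour d => e.2.2.1), hcolours, Set.ncard_coe_finset,
    Finset.card_insert_of_notMem, Nat.card_Icc]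
  · omega
  · rw [Finset.mem_Icc]
    omega
  · intro e he e' he' h
    rcases (mem_imageTwo_edges hd).1 he with rfl | rfl | ⟨k, h1, h2, rfl⟩ <;>
    rcases (mem_imageTwo_edges hd).1 he' with rfl | rfl | ⟨k', h1', h2', rfl⟩ <;>
    simp only at h <;> first | rfl | (exfalso; omega) | skip
    obtain rfl : k = k' := by omega
    rfl

theorem Admissible.degree_leaf (hX : Admissible X) {x y : Vertex} {c : Colour d} {k : ℕ}
    (hf : (x, y, c) ∈ X.edges) :
    degree (TreeSub.tau hd X) (.leaf x y k) ≤ 1 := by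
  have hall : ∀ e ∈ (TreeSub.tau hd X).edges, e.1 = .leaf x y k ∨ e.2.1 = .leaf x y k →
      e.1 = .centre x y ∧ e.2.1 = .leaf x y k ∧ e.2.2.1 = d + k := by
    intro e he hev
    rcases (mem_tau_edges hd).1 he with ⟨x', y', c', hf', hc', rfl⟩ | ⟨x', y', c', hf', hc', he⟩
    · rcases hev with h | h
      · exact absurd h (hX.source_ne_leaf hf' hf)
      · exact absurd h (hX.target_ne_leaf hf' hf)
    · rcases (mem_imageTwo_edges hd).1 he with rfl | rfl | ⟨k, h1, h2, rfl⟩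
      · rcases hev with h | h
        · cases h
        · exact absurd h (hX.source_ne_leaf hf' hf)
      · rcases hev with h | h
        · cases h
        · exact absurd h (hX.target_ne_leaf hf' hf)
      · rcases hev with h | h
        · cases h
        · cases h
          exact ⟨rfl, rfl, rfl⟩
  have hsub : {e ∈ (TreeSub.tau hd X).edges |
      e.1 = .leaf x y k ∨ e.2.1 = .leaf x y k}.Subsingleton := by
    rintro e ⟨he, hev⟩ e' ⟨he', hev'⟩
    obtain ⟨h1, h2, h3⟩ := hall e he hev
    obtain ⟨h1', h2', h3'⟩ := hall e' he' hev'
    exact Prod.ext (h1.trans h1'.symm)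
      (Prod.ext (h2.trans h2'.symm) (Subtype.ext (h3.trans h3'.symm)))
  rw [degree, Set.ncard_le_one hsub.finite]
  exact fun a ha b hb => hsub ha hb

end

/-! ### The iterates of the tree substitution -/

section

variable {d : ℕ} (hd : 3 ≤ d)

/-- The tree `τᵗ(X_2)`. -/
def stage (t : ℕ) : ColouredGraph Vertex (Colour d) :=
  (tau hd)^[t] (singleEdge .source .target ⟨2, by omega⟩)

theorem stage_succ (t : ℕ) : stage hd (t + 1) = tau hd (stage hd t) :=
  Function.iterate_succ_apply' _ _ _

theorem tree_eq_stage (n : ℕ) : tree hd n = stage hd (n + (d - 1)) :=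
  (Function.iterate_add_apply _ _ _ _).symm

theorem mem_stage_zero_edges {x y : Vertex} {c : Colour d} :
    (x, y, c) ∈ (stage hd 0).edges ↔ x = .source ∧ y = .target ∧ c = ⟨2, by omega⟩ := by
  show (x, y, c) = _ ↔ _
  simp only [Prod.mk.injEq]

theorem admissible_stage (t : ℕ) : Admissible (stage hd t) := by
  induction t with
  | succ t ih =>
    rw [stage_succ]
    exact ih.tau
  | zero =>
    constructor
    · intro x y c h
      exact Or.inl ((mem_stage_zero_edges hd).1 h).1
    · intro x y c h
      exact Or.inr ((mem_stage_zero_edges hd).1 h).2.1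
    · intro v hv
      exact ⟨_, rfl, hv⟩
    · intro x y h
      rcases h with h | h <;> cases h
    · intro x y k h
      rcases h with h | h <;> cases h
    · intro x y c _ h
      rcases h with h | h <;> cases h
    · intro x y c k _ h
      rcases h with h | h <;> cases h
    · intro x y c c' h h'
      rw [((mem_stage_zero_edges hd).1 h).2.2, ((mem_stage_zero_edges hd).1 h').2.2]
    · intro x y c h hxy
      obtain ⟨rfl, rfl, -⟩ := (mem_stage_zero_edges hd).1 h
      cases hxy

theorem stage_verts_mono {s t : ℕ} (h : s ≤ t) : (stage hd s).verts ⊆ (stage hd t).verts := by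
  induction t, h using Nat.le_induction with
  | base => exact subset_rfl
  | succ t _ ih =>
    intro v hv
    rw [stage_succ]
    exact (admissible_stage hd t).mem_tau_verts.2 (Or.inl (ih hv))

/-- The vertices that subdivide the edges of colour `2` of `τᵗ(X_2)`. -/
def newCentres (t : ℕ) : Set Vertex :=
  {v | ∃ x y c, (x, y, c) ∈ (stage hd t).edges ∧ c.1 = 2 ∧ v = .centre x y}

variable {hd}

theorem mem_stage_of_newCentres {s t : ℕ} {v : Vertex} (hv : v ∈ newCentres hd s) (h : s < t) :
    v ∈ (stage hd t).verts := by
  obtain ⟨x, y, c, hf, hc, rfl⟩ := hv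
  refine stage_verts_mono hd h ?_
  rw [stage_succ]
  exact (admissible_stage hd s).mem_tau_verts.2 (Or.inr ⟨x, y, c, hf, hc, Or.inl rfl⟩)

theorem notMem_stage_of_newCentres {s t : ℕ} {v : Vertex} (hv : v ∈ newCentres hd s)
    (h : t ≤ s) : v ∉ (stage hd t).verts := by
  obtain ⟨x, y, c, hf, hc, rfl⟩ := hv
  exact fun hv => (admissible_stage hd s).centre_notMem hf (stage_verts_mono hd h hv)

theorem newCentres_zero {v : Vertex} : v ∈ newCentres hd 0 ↔ v = root := by
  constructor
  · rintro ⟨x, y, c, hf, -, rfl⟩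
    obtain ⟨rfl, rfl, -⟩ := (mem_stage_zero_edges hd).1 hf
    rfl
  · rintro rfl
    exact ⟨_, _, ⟨2, by omega⟩, (mem_stage_zero_edges hd).2 ⟨rfl, rfl, rfl⟩, rfl, rfl⟩

theorem root_mem_stage {t : ℕ} (h : 0 < t) : root ∈ (stage hd t).verts :=
  mem_stage_of_newCentres (newCentres_zero.2 rfl) h

theorem degree_newCentres {s t : ℕ} {v : Vertex} (hv : v ∈ newCentres hd s) (h : s < t) :
    degree (stage hd t) v = d := by
  induction t, Nat.succ_le_of_lt h using Nat.le_induction with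
  | base =>
    obtain ⟨x, y, c, hf, hc, rfl⟩ := hv
    rw [Nat.succ_eq_add_one, stage_succ]
    exact (admissible_stage hd s).degree_centre hf hc
  | succ t ht ih =>
    rw [stage_succ, (admissible_stage hd t).degree_tau (mem_stage_of_newCentres hv ht), ih ht]

/-- Degrees never change after creation, so the leaves and the two initial ends keep degree at most
1. As `d ≥ 3`, the branch points are exactly the centres. -/
theorem newCentres_or_degree_le_one {t : ℕ} {v : Vertex} (hv : v ∈ (stage hd t).verts) :
    (∃ s < t, v ∈ newCentres hd s) ∨ degree (stage hd t) v ≤ 1 := by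
  induction t with
  | zero =>
    have hsub : {e ∈ (stage hd 0).edges | e.1 = v ∨ e.2.1 = v}.Subsingleton := by
      rintro e ⟨he, -⟩ e' ⟨he', -⟩
      exact Eq.trans he (Eq.symm he')
    right
    rw [degree, Set.ncard_le_one hsub.finite]
    exact fun a ha b hb => hsub ha hb
  | succ t ih =>
    have hX := admissible_stage hd t
    rw [stage_succ] at hv ⊢
    rcases hX.mem_tau_verts.1 hv with hv | ⟨x, y, c, hf, hc, rfl | ⟨k, -, -, rfl⟩⟩
    · rcases ih hv with ⟨s, hs, h⟩ | h
      · exact Or.inl ⟨s, by omega, h⟩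
      · exact Or.inr (by rwa [hX.degree_tau hv])
    · exact Or.inl ⟨t, by omega, x, y, c, hf, hc, rfl⟩
    · exact Or.inr (hX.degree_leaf hf)

theorem mem_branchPoints_iff {n : ℕ} {v : Vertex} :
    v ∈ branchPoints hd n ↔ ∃ s < n + (d - 1), v ∈ newCentres hd s := by
  rw [branchPoints, tree_eq_stage]
  constructor
  · rintro ⟨hv, hdeg⟩
    refine (newCentres_or_degree_le_one hv).resolve_right ?_
    omega
  · rintro ⟨s, hs, hv⟩
    exact ⟨mem_stage_of_newCentres hv hs, degree_newCentres hv hs⟩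

/-! ### The ages of the edges -/

/-- The number of steps after which an edge of colour `c` gets the colour `2`. -/
def delay (c : Colour d) : ℕ :=
  if c.1 = 1 then d - 1 else if c.1 ≤ d then c.1 - 2 else c.1 - 1

variable (hd) in
theorem nextColour_val (c : Colour d) :
    (nextColour hd c).1 = if c.1 = 1 then d else if c.1 = d + 1 then 1 else c.1 - 1 := by
  rw [nextColour]
  split_ifs <;> rfl

theorem delay_nextColour {c : Colour d} (hc : c.1 ≠ 2) :
    delay (nextColour hd c) + 1 = delay c := by
  have := c.2
  have h := nextColour_val hd c
  rw [delay, delay]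
  split_ifs at h ⊢ <;> omega

theorem delay_eq_zero_iff {c : Colour d} : delay c = 0 ↔ c.1 = 2 := by
  have := c.2
  rw [delay]
  split_ifs <;> omega

/-- The sum `t + delay c` is constant during the life of an edge: it is the stage at which the edge
is subdivided. At birth, in stage `s + 1`, the delays run from `d - 2` to `2d - 3`. -/
theorem source_mem_newCentres {t : ℕ} (ht : 0 < t) {x y : Vertex} {c : Colour d}
    (h : (x, y, c) ∈ (stage hd t).edges) :
    ∃ s < t, x ∈ newCentres hd s ∧ s + (d - 1) ≤ t + delay c ∧ t + delay c ≤ s + (2 * d - 2) := by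
  induction t generalizing x y c with
  | zero => omega
  | succ t ih =>
    rw [stage_succ] at h
    rcases (mem_tau_edges hd).1 h with ⟨x', y', c', hf, hc, he⟩ | ⟨x', y', c', hf, hc, he⟩
    · cases he
      rcases Nat.eq_zero_or_pos t with rfl | ht
      · obtain ⟨-, -, h2⟩ := (mem_stage_zero_edges hd).1 hf
        exact absurd (congrArg Subtype.val h2) hc
      · obtain ⟨s, hs, hx, h1, h2⟩ := ih ht hf
        have := delay_nextColour (hd := hd) hc
        exact ⟨s, by omega, hx, by omega, by omega⟩
    · have hnew : Vertex.centre x' y' ∈ newCentres hd t := ⟨x', y', c', hf, hc, rfl⟩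
      rcases (mem_imageTwo_edges hd).1 he with he | he | ⟨k, h1, h2, he⟩ <;> cases he <;>
        refine ⟨t, by omega, hnew, ?_⟩ <;> rw [delay]
      · rw [if_neg (by simp only; omega), if_pos le_rfl]
        simp only
        omega
      · rw [if_pos rfl]
        omega
      · rw [if_neg (by simp only; omega), if_neg (by simp only; omega)]
        simp only
        omega

theorem exists_edge_of_newCentres {s t j : ℕ} {x : Vertex} (hx : x ∈ newCentres hd s)
    (hst : s < t) (h1 : s + (d - 1) ≤ t + j) (h2 : t + j ≤ s + (2 * d - 2)) :
    ∃ y c, (x, y, c) ∈ (stage hd t).edges ∧ delay c = j := by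
  induction t, Nat.succ_le_of_lt hst using Nat.le_induction generalizing j with
  | base =>
    obtain ⟨x, y, c, hf, hc, rfl⟩ := hx
    rw [Nat.succ_eq_add_one, stage_succ]
    have key : ∀ e ∈ (imageTwo hd x y).edges, e ∈ (TreeSub.tau hd (stage hd s)).edges :=
      fun e he => (mem_tau_edges hd).2 (Or.inr ⟨x, y, c, hf, hc, he⟩)
    by_cases hj : j = d - 2
    · refine ⟨_, _, key _ (Or.inl (Or.inl rfl)), ?_⟩
      rw [delay, if_neg (by simp only; omega), if_pos le_rfl]
      exact hj.symm
    by_cases hj' : j = d - 1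
    · refine ⟨_, _, key _ (Or.inl (Or.inr rfl)), ?_⟩
      rw [delay, if_pos rfl]
      exact hj'.symm
    · refine ⟨_, _, key _ (Or.inr ⟨j + 1 - d, by omega, by omega, rfl⟩), ?_⟩
      rw [delay, if_neg (by simp only; omega), if_neg (by simp only; omega)]
      simp only
      omega
  | succ t ht ih =>
    -- An edge with delay `j` now had delay `j + 1` one stage earlier.
    obtain ⟨y, c, hf, hc⟩ := ih (j := j + 1) ht (by omega) (by omega)
    have hc2 : c.1 ≠ 2 := by
      rw [Ne, ← delay_eq_zero_iff]
      omega
    have := delay_nextColour (hd := hd) hc2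
    refine ⟨y, nextColour hd c, ?_, by omega⟩
    rw [stage_succ]
    exact (mem_tau_edges hd).2 (Or.inl ⟨x, y, c, hf, hc2, rfl⟩)

/-! ### Paths -/

theorem IsPathWord.append {X : ColouredGraph Vertex (Colour d)} {x y z : Vertex}
    {w w' : List (Colour d × Bool)} (h : IsPathWord X x y w) (h' : IsPathWord X y z w') :
    IsPathWord X x z (w ++ w') := by
  induction h with
  | nil => exact h'
  | forward x y _ a w he _ ih => exact .forward x y _ a _ he (ih h')
  | backward x y _ a w he _ ih => exact .backward x y _ a _ he (ih h')

theorem Admissible.exists_isPathWord_tau {X : ColouredGraph Vertex (Colour d)} (hX : Admissible X)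
    {x y : Vertex} {w : List (Colour d × Bool)} (h : IsPathWord X x y w) :
    ∃ w', IsPathWord (TreeSub.tau hd X) x y w' := by
  have himage : ∀ {x y c}, (x, y, c) ∈ X.edges → c.1 = 2 →
      ∀ e ∈ (imageTwo hd x y).edges, e ∈ (TreeSub.tau hd X).edges :=
    fun hf hc e he => (mem_tau_edges hd).2 (Or.inr ⟨_, _, _, hf, hc, he⟩)
  induction h with
  | nil x hx => exact ⟨[], .nil x (hX.mem_tau_verts.2 (Or.inl hx))⟩
  | forward x y z c w he _ ih =>
    obtain ⟨w', hw'⟩ := ih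
    by_cases hc : c.1 = 2
    · exact ⟨_, .backward x _ _ _ _ (himage he hc _ (Or.inl (Or.inl rfl)))
        (.forward _ _ _ _ _ (himage he hc _ (Or.inl (Or.inr rfl))) hw')⟩
    · exact ⟨_, .forward x y _ _ _ ((mem_tau_edges hd).2 (Or.inl ⟨x, y, c, he, hc, rfl⟩)) hw'⟩
  | backward x y z c w he _ ih =>
    obtain ⟨w', hw'⟩ := ih
    by_cases hc : c.1 = 2
    · exact ⟨_, .backward x _ _ _ _ (himage he hc _ (Or.inl (Or.inr rfl)))
        (.forward _ _ _ _ _ (himage he hc _ (Or.inl (Or.inl rfl))) hw')⟩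
    · exact ⟨_, .backward x y _ _ _ ((mem_tau_edges hd).2 (Or.inl ⟨y, x, c, he, hc, rfl⟩)) hw'⟩

theorem exists_isPathWord_root {t : ℕ} (ht : 0 < t) {v : Vertex} (hv : v ∈ (stage hd t).verts) :
    ∃ w, IsPathWord (stage hd t) root v w := by
  obtain ⟨t, rfl⟩ : ∃ t', t = t' + 1 := ⟨t - 1, by omega⟩
  clear ht
  induction t generalizing v with
  | zero =>
    have hX := admissible_stage hd 0
    have hf : (.source, .target, ⟨2, by omega⟩) ∈ (stage hd 0).edges := rfl
    rw [zero_add, ← zero_add 1, stage_succ] at hv ⊢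
    have key : ∀ e ∈ (imageTwo hd .source .target).edges, e ∈ (tau hd (stage hd 0)).edges :=
      fun e he => (mem_tau_edges hd).2 (Or.inr ⟨_, _, _, hf, rfl, he⟩)
    rcases hX.mem_tau_verts.1 hv with h | ⟨x, y, c, hf, hc, h⟩
    · rcases h with rfl | rfl
      · exact ⟨_, .forward _ _ _ _ _ (key _ (Or.inl (Or.inl rfl))) (.nil _ hv)⟩
      · exact ⟨_, .forward _ _ _ _ _ (key _ (Or.inl (Or.inr rfl))) (.nil _ hv)⟩
    · obtain ⟨rfl, rfl, -⟩ := (mem_stage_zero_edges hd).1 hf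
      rcases h with rfl | ⟨k, h1, h2, rfl⟩
      · exact ⟨_, .nil _ hv⟩
      · exact ⟨_, .forward _ _ _ _ _ (key _ (Or.inr ⟨k, h1, h2, rfl⟩)) (.nil _ hv)⟩
  | succ t ih =>
    have hX := admissible_stage hd (t + 1)
    rw [stage_succ] at hv ⊢
    rcases hX.mem_tau_verts.1 hv with h | ⟨x, y, c, hf, hc, h⟩
    · obtain ⟨w, hw⟩ := ih h
      exact hX.exists_isPathWord_tau hw
    · obtain ⟨w, hw⟩ := ih (hX.source_mem hf)
      obtain ⟨w', hw'⟩ := hX.exists_isPathWord_tau (hd := hd) hw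
      have key : ∀ e ∈ (imageTwo hd x y).edges, e ∈ (tau hd (stage hd (t + 1))).edges :=
        fun e he => (mem_tau_edges hd).2 (Or.inr ⟨_, _, _, hf, hc, he⟩)
      have hcentre : Vertex.centre x y ∈ (tau hd (stage hd (t + 1))).verts :=
        hX.mem_tau_verts.2 (Or.inr ⟨_, _, _, hf, hc, Or.inl rfl⟩)
      have h1 := hw'.append (.backward _ _ _ _ _ (key _ (Or.inl (Or.inl rfl))) (.nil _ hcentre))
      rcases h with rfl | ⟨k, hk1, hk2, rfl⟩
      · exact ⟨_, h1⟩
      · exact ⟨_, h1.append (.forward _ _ _ _ _ (key _ (Or.inr ⟨k, hk1, hk2, rfl⟩)) (.nil _ hv))⟩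

/-- Existence of a path suffices for the chosen word to be a path word. Its minimality plays no
further role, since a potential gives the same value along all paths. -/
theorem isPathWord_pathFun {X : ColouredGraph Vertex (Colour d)} {x y : Vertex}
    (h : ∃ w, IsPathWord X x y w) : IsPathWord X x y (pathFun X x y) := by
  obtain ⟨w, hw, hmin⟩ := (measure List.length).wf.has_min {w | IsPathWord X x y w} h
  have := Classical.epsilon_spec (p := fun w => IsPathWord X x y w ∧
    ∀ w', IsPathWord X x y w' → w.length ≤ w'.length)
    ⟨w, hw, fun w' hw' => Nat.le_of_not_lt (hmin w' hw')⟩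
  exact this.1

/-! ### Potentials -/

/-- `g` is a potential of `X` for which an edge of colour `c` has weight `σᵗ(p_*(c))`. -/
def IsPotential (hd : 3 ≤ d) (t : ℕ) (X : ColouredGraph Vertex (Colour d))
    (g : Vertex → FreeGroup (Letter d)) : Prop :=
  ∀ {x y c}, (x, y, c) ∈ X.edges → g y = g x * (sigma hd)^[t] (pColour hd c)

theorem IsPotential.eq_mul {t : ℕ} {X : ColouredGraph Vertex (Colour d)}
    {g : Vertex → FreeGroup (Letter d)} (hg : IsPotential hd t X g) {x y : Vertex}
    {w : List (Colour d × Bool)} (h : IsPathWord X x y w) :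
    g y = g x * (sigma hd)^[t] (pStar hd w) := by
  induction h with
  | nil => simp [pStar, iterate_map_one]
  | forward x y z c w he _ ih =>
    have : pStar hd ((c, true) :: w) = pColour hd c * pStar hd w := by simp [pStar]
    rw [ih, hg he, this, iterate_map_mul, mul_assoc]
  | backward x y z c w he _ ih =>
    have : pStar hd ((c, false) :: w) = (pColour hd c)⁻¹ * pStar hd w := by simp [pStar]
    rw [ih, hg he, this, iterate_map_mul, iterate_map_inv, mul_assoc, mul_inv_cancel_left]

variable (hd) in
theorem sigma_of (a : Letter d) : sigma hd (FreeGroup.of a) = ofWord (sigmaLetter hd a) := by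
  rw [sigma, FreeGroup.lift_apply_of]

theorem sigma_pColour_nextColour {c : Colour d} (hc : c.1 ≠ 2) :
    sigma hd (pColour hd (nextColour hd c)) = pColour hd c := by
  obtain ⟨c, hc1, hc2⟩ := c
  simp only at hc
  have hone : ∀ a, ofWord [a] = (FreeGroup.of a : FreeGroup (Letter d)) := by simp [ofWord]
  rcases Nat.lt_or_ge c 2 with h | h
  · obtain rfl : c = 1 := by omega
    rw [nextColour, dif_pos rfl, pColour, pColour, dif_pos le_rfl, dif_pos (by simp only; omega),
      sigma_of, sigmaLetter, if_neg (by simp only; omega), dif_neg (by simp only; omega), hone]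
  by_cases hcd : c = d + 1
  · subst hcd
    have hn : nextColour hd ⟨d + 1, hc1, hc2⟩ = ⟨1, by omega⟩ := by
      rw [nextColour, dif_neg (by simp only; omega), if_pos rfl]
    rw [hn, pColour, pColour, dif_pos (by simp only; omega), dif_neg (by simp only; omega)]
    simp only [Nat.add_sub_cancel_left]
    rfl
  have hn : nextColour hd ⟨c, hc1, hc2⟩ = ⟨c - 1, by omega⟩ := by
    rw [nextColour, dif_neg (by simp only; omega), if_neg hcd]
  rcases Nat.lt_or_ge d c with h' | h'
  · rw [hn, pColour, pColour, dif_neg (by simp only; omega), dif_neg (by simp only; omega),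
      ← Function.iterate_succ_apply' (sigma hd)]
    congr 2
    simp only
    omega
  · rw [hn, pColour, pColour, dif_pos (by simp only; omega), dif_pos h', sigma_of, sigmaLetter,
      if_neg (by simp only; omega), dif_pos (by simp only; omega), hone]
    congr 2
    simp only
    omega

/-- Recoloured edges keep their weight because `σ(p_*(c'))` is `p_*(c)` when `c'` follows `c`. The
two halves of an edge of colour 2 compose correctly because `σ(d) = 1` and `σ^t(1)⁻¹ σ^{t+1}(1) =
σ^t(2)`. -/
theorem IsPotential.tau {t : ℕ} {X : ColouredGraph Vertex (Colour d)} (hX : Admissible X)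
    {g g' : Vertex → FreeGroup (Letter d)} (hg : IsPotential hd t X g)
    (hold : ∀ v ∈ X.verts, g' v = g v)
    (hcentre : ∀ {x y c}, (x, y, c) ∈ X.edges →
      g' (.centre x y) = g x * ((sigma hd)^[t] (FreeGroup.of (letterOne hd)))⁻¹)
    (hleaf : ∀ {x y c h}, (x, y, c) ∈ X.edges → g' (.leaf x y h) =
      g' (.centre x y) * (sigma hd)^[t + 1] ((sigma hd)^[h] (FreeGroup.of (letterOne hd)))) :
    IsPotential hd (t + 1) (TreeSub.tau hd X) g' := by
  have hone : ∀ a, ofWord [a] = (FreeGroup.of a : FreeGroup (Letter d)) := by simp [ofWord]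
  intro x y c h
  rcases (mem_tau_edges hd).1 h with ⟨x', y', c', hf, hc, he⟩ | ⟨x', y', c', hf, hc, he⟩
  · cases he
    rw [hold _ (hX.source_mem hf), hold _ (hX.target_mem hf), Function.iterate_succ_apply,
      sigma_pColour_nextColour hc, hg hf]
  · rcases (mem_imageTwo_edges hd).1 he with he | he | ⟨k, h1, h2, he⟩ <;> cases he
    · rw [hold _ (hX.source_mem hf), hcentre hf, Function.iterate_succ_apply, pColour,
        dif_pos le_rfl, sigma_of, sigmaLetter, if_neg (by simp only; omega),
        dif_neg (by simp only; omega), hone, letterOne, inv_mul_cancel_right]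
    · have hp : pColour hd c' = FreeGroup.of ⟨2, by omega, by omega⟩ := by
        rw [pColour, dif_pos (by omega)]
        congr 2
      have hs : sigma hd (FreeGroup.of (letterOne hd)) =
          FreeGroup.of (letterOne hd) * FreeGroup.of ⟨2, by omega, by omega⟩ := by
        rw [sigma_of, letterOne, sigmaLetter, if_pos rfl]
        simp [ofWord]
      rw [hold _ (hX.target_mem hf), hcentre hf, Function.iterate_succ_apply, pColour,
        dif_pos (by simp only; omega), hg hf, hp]
      change _ = _ * (sigma hd)^[t] (sigma hd (FreeGroup.of (letterOne hd)))
      rw [hs, iterate_map_mul, mul_assoc, inv_mul_cancel_left]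
    · rw [hleaf hf, pColour, dif_neg (by simp only; omega)]
      simp only [Nat.add_sub_cancel_left]

variable (hd) in
open Classical in
/-- The potential of `τᵗ(X_2)` that vanishes at the source of the initial edge. -/
noncomputable def potential : ℕ → Vertex → FreeGroup (Letter d)
  | 0, .target => FreeGroup.of ⟨2, by omega, by omega⟩
  | 0, _ => 1
  | t + 1, v =>
    if v ∈ (stage hd t).verts then potential t v
    else match v with
      | .centre x _ => potential t x * ((sigma hd)^[t] (FreeGroup.of (letterOne hd)))⁻¹
      | .leaf x _ h => potential t x * ((sigma hd)^[t] (FreeGroup.of (letterOne hd)))⁻¹ *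
          (sigma hd)^[t + 1] ((sigma hd)^[h] (FreeGroup.of (letterOne hd)))
      | _ => 1

theorem potential_succ {t : ℕ} {v : Vertex} (hv : v ∈ (stage hd t).verts) :
    potential hd (t + 1) v = potential hd t v := by
  rw [potential.eq_def]
  exact if_pos hv

theorem potential_centre {t : ℕ} {x y : Vertex} {c : Colour d}
    (h : (x, y, c) ∈ (stage hd t).edges) : potential hd (t + 1) (.centre x y)
      = potential hd t x * ((sigma hd)^[t] (FreeGroup.of (letterOne hd)))⁻¹ := by
  rw [potential, if_neg ((admissible_stage hd t).centre_notMem h)]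

theorem isPotential_potential (t : ℕ) : IsPotential hd t (stage hd t) (potential hd t) := by
  induction t with
  | zero =>
    intro x y c h
    obtain ⟨rfl, rfl, hc⟩ := (mem_stage_zero_edges hd).1 h
    rw [hc, pColour, dif_pos (by simp only; omega)]
    simp [potential]
  | succ t ih =>
    rw [stage_succ]
    refine ih.tau (admissible_stage hd t) (fun v hv => potential_succ hv) potential_centre ?_
    intro x y c k h
    rw [potential_centre h, potential, if_neg ((admissible_stage hd t).leaf_notMem k h)]

theorem potential_eq_of_le {s t : ℕ} (h : s ≤ t) {v : Vertex} (hv : v ∈ (stage hd s).verts) :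
    potential hd t v = potential hd s v := by
  induction t, h using Nat.le_induction with
  | base => rfl
  | succ t ht ih => rw [potential_succ (stage_verts_mono hd ht hv), ih]

/-! ### The words attached to the branch points -/

variable (hd) in
-- The inverse sends `1 ↦ d`, `2 ↦ d⁻¹1` and `k ↦ k-1` otherwise. Injectivity lets the factor
-- `σ^{d-1}` be cancelled, which separates stage potentials from words attached to vertices.
theorem sigma_injective : Function.Injective (sigma hd) := by
  let g : Letter d → FreeGroup (Letter d) := fun a =>
    if h1 : a.1 = 1 then FreeGroup.of ⟨d, by omega, le_rfl⟩
    else if h2 : a.1 = 2 then (FreeGroup.of ⟨d, by omega, le_rfl⟩)⁻¹ * FreeGroup.of (letterOne hd)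
    else FreeGroup.of ⟨a.1 - 1, by have := a.2; omega, by have := a.2; omega⟩
  have hcomp : (FreeGroup.lift g).comp (sigma hd) = MonoidHom.id _ := by
    ext a
    rw [MonoidHom.comp_apply, MonoidHom.id_apply, sigma_of, sigmaLetter]
    obtain ⟨a, ha1, ha2⟩ := a
    split_ifs with h1 h2
    · simp only at h1
      subst h1
      simp [ofWord, g, letterOne]
    · simp only at h1 h2
      simp [ofWord, g, h1, show a ≠ 0 by omega]
    · simp only at h1 h2
      simp [ofWord, g, show a = d by omega]
  exact Function.LeftInverse.injective (g := FreeGroup.lift g) fun x => DFunLike.congr_fun hcomp x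

/-- Tree `n` is stage `n + (d-1)`, whose weights carry `d - 1` more iterations of `σ` than `wordAt`.
The potential is normalised at the source of the initial edge, so the value at the root is divided
out. -/
theorem sigma_iterate_wordAt {n : ℕ} {v : Vertex} (hv : v ∈ (tree hd n).verts) :
    (sigma hd)^[d - 1] (wordAt hd n v) =
      (potential hd (n + (d - 1)) root)⁻¹ * potential hd (n + (d - 1)) v := by
  rw [tree_eq_stage] at hv
  have hpath := isPathWord_pathFun (exists_isPathWord_root (by omega) hv)
  rw [IsPotential.eq_mul (isPotential_potential (n + (d - 1))) hpath, inv_mul_cancel_left, wordAt,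
    tree_eq_stage, ← Function.iterate_add_apply, Nat.add_comm]

theorem wordAt_eq_wordAt {m n : ℕ} {v : Vertex} (hm : v ∈ (tree hd m).verts)
    (hn : v ∈ (tree hd n).verts) : wordAt hd m v = wordAt hd n v := by
  wlog h : m ≤ n generalizing m n
  · exact (this hn hm (by omega)).symm
  apply (sigma_injective hd).iterate (d - 1)
  rw [sigma_iterate_wordAt hm, sigma_iterate_wordAt hn]
  rw [tree_eq_stage] at hm
  rw [potential_eq_of_le (t := n + (d - 1)) (Nat.add_le_add_right h _) hm,
    potential_eq_of_le (t := n + (d - 1)) (Nat.add_le_add_right h _) (root_mem_stage (by omega))]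

theorem fZero_eq_wordAt {n : ℕ} {v : Vertex} (hn : v ∈ (tree hd n).verts) :
    fZero hd v = wordAt hd n v :=
  wordAt_eq_wordAt (Nat.sInf_mem (s := {k | v ∈ (tree hd k).verts}) ⟨n, hn⟩) hn

variable (hd) in
/-- The branch point `v`, created at time `t + 1`, has the word `u⁻¹`. -/
def HasWord (t : ℕ) (v : Vertex) (u : List (Letter d)) : Prop :=
  potential hd (t + 1) v = potential hd (t + 1) root * ((sigma hd)^[d - 1] (ofWord u))⁻¹

theorem hasWord_root : HasWord hd 0 root [] := by
  rw [HasWord]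
  simp [ofWord, iterate_map_one]

/-- The step from the parent to the new centre contributes `σ^t(1)⁻¹`. As `t ≥ d - 1`, the common
`σ^{d-1}` factors out and leaves the exponent `t + 1 - d`. -/
theorem HasWord.centre {s t : ℕ} {x y : Vertex} {c : Colour d} {u : List (Letter d)}
    (hx : x ∈ newCentres hd s) (h : HasWord hd s x u) (hst : s + (d - 1) ≤ t)
    (hf : (x, y, c) ∈ (stage hd t).edges) :
    HasWord hd t (.centre x y) (sigmaOne hd (t + 1 - d) ++ u) := by
  have h1 : t + 1 - d + (d - 1) = t := by omega
  rw [HasWord, potential_centre hf,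
    potential_eq_of_le (s := s + 1) (by omega) (mem_stage_of_newCentres hx (by omega)), h,
    potential_eq_of_le (s := s + 1) (t := t + 1) (by omega) (root_mem_stage (by omega)),
    sigma_iterate_ofWord, sigma_iterate_ofWord, sigmaWord_iterate_append,
    sigmaWord_iterate_sigmaOne, h1, ofWord_append, mul_inv_rev, sigma_iterate_of_one, mul_assoc]

theorem exists_hasWord {t : ℕ} {v : Vertex} (hv : v ∈ newCentres hd t) :
    ∃ u, BranchWord hd (t + 1) u ∧ HasWord hd t v u := by
  induction t using Nat.strong_induction_on generalizing v with
  | _ t ih =>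
    rcases Nat.eq_zero_or_pos t with rfl | ht
    · obtain rfl := newCentres_zero.1 hv
      exact ⟨[], .root, hasWord_root⟩
    · obtain ⟨x, y, c, hf, hc, rfl⟩ := hv
      obtain ⟨s, hs, hx, h1, h2⟩ := source_mem_newCentres ht hf
      rw [delay_eq_zero_iff.2 hc] at h1 h2
      obtain ⟨u, hu, hw⟩ := ih s hs hx
      exact ⟨_, .step _ _ u hu (by omega) (by omega), hw.centre hx (by omega) hf⟩

theorem BranchWord.exists_newCentres {t : ℕ} {u : List (Letter d)} (h : BranchWord hd t u) :
    ∃ v ∈ newCentres hd (t - 1), HasWord hd (t - 1) v u := by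
  induction h with
  | root => exact ⟨TreeSub.root, newCentres_zero.2 rfl, hasWord_root⟩
  | step s t u h h1 h2 ih =>
    obtain ⟨x, hx, hw⟩ := ih
    have hs : 1 ≤ s := by
      rcases h.time with h | h <;> omega
    obtain ⟨y, c, hf, hc⟩ := exists_edge_of_newCentres (t := t - 1) (j := 0) hx (by omega)
      (by omega) (by omega)
    refine ⟨.centre x y, ⟨x, y, c, hf, delay_eq_zero_iff.1 hc, rfl⟩, ?_⟩
    have := hw.centre hx (by omega) hf
    rwa [Nat.sub_add_cancel (by omega)] at this

theorem wordAt_eq_of_hasWord {s n : ℕ} {v : Vertex} {u : List (Letter d)}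
    (hv : v ∈ newCentres hd s) (hs : s < n + (d - 1)) (h : HasWord hd s v u) :
    wordAt hd n v = (ofWord u)⁻¹ := by
  apply (sigma_injective hd).iterate (d - 1)
  have hmem : v ∈ (tree hd n).verts := by
    rw [tree_eq_stage]
    exact mem_stage_of_newCentres hv hs
  rw [sigma_iterate_wordAt hmem,
    potential_eq_of_le (s := s + 1) hs (mem_stage_of_newCentres hv (by omega)), h,
    potential_eq_of_le (s := s + 1) hs (root_mem_stage (by omega)), inv_mul_cancel_left,
    iterate_map_inv]

/-- A branch point of tree `m` absent from tree `m - 1` is a centre created exactly at time `m +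
(d-1)`; earlier centres are already vertices of tree `m - 1`. -/
theorem appearsAt_iff {m : ℕ} (hm : 1 ≤ m) {w : FreeGroup (Letter d)} :
    AppearsAt hd m w ↔ ∃ u, BranchWord hd (m + (d - 1)) u ∧ w = (ofWord u)⁻¹ := by
  rw [AppearsAt, if_neg (by omega), Int.toNat_natCast]
  constructor
  · rintro ⟨x, hx, hx', rfl⟩
    obtain ⟨s, hs, hv⟩ := mem_branchPoints_iff.1 hx
    have hs' : s + 1 = m + (d - 1) := by
      by_contra hne
      refine hx' ?_
      rw [tree_eq_stage]
      exact mem_stage_of_newCentres hv (by omega)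
    obtain ⟨u, hu, hw⟩ := exists_hasWord hv
    rw [hs'] at hu
    exact ⟨u, hu, wordAt_eq_of_hasWord hv hs hw⟩
  · rintro ⟨u, hu, rfl⟩
    obtain ⟨v, hv, hw⟩ := hu.exists_newCentres
    refine ⟨v, mem_branchPoints_iff.2 ⟨_, by omega, hv⟩, ?_,
      (wordAt_eq_of_hasWord hv (by omega) hw).symm⟩
    rw [tree_eq_stage]
    exact notMem_stage_of_newCentres hv (by omega)

end

end TreeSub

/-! ### The theorem, read off from the recursion on words -/

open TreeSub in
theorem mainTheorem8 (d : ℕ) (hd : 3 ≤ d) :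
    -- for `m ≥ 1`, `l_m` is the inverse of a bispecial word
    (∀ m : ℕ, 1 ≤ m → ∃ u : List (Letter d), IsBispecial hd u ∧ lWord hd m = (ofWord u)⁻¹) ∧
    -- (1) for `1 ≤ m ≤ d-1`, `l_m` is the only word that appears at step `m`
    (∀ m : ℕ, 1 ≤ m → m ≤ d - 1 →
      ∀ w : FreeGroup (Letter d), AppearsAt hd m w ↔ w = lWord hd m) ∧
    -- (2) for `m ≥ d`, `l_m` is the longest word that appears at step `m`
    (∀ m : ℕ, d ≤ m → AppearsAt hd m (lWord hd m) ∧
      ∀ w : FreeGroup (Letter d), AppearsAt hd m w → w ≠ lWord hd m →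
        w.norm < (lWord hd m).norm) ∧
    -- (3) `f_0` is well defined on, and maps, the branch points of `T_m^s` to suffixes of `l_m`
    (∀ m : ℕ, ∀ x ∈ branchPoints hd m,
      (∀ k : ℕ, x ∈ (tree hd k).verts → fZero hd x = wordAt hd k x) ∧
      IsSuffix (fZero hd x) (lWord hd m)) ∧
    -- (4) every suffix of `l_m` has appeared at some step `≤ m`
    (∀ m : ℕ, ∀ w : FreeGroup (Letter d), IsSuffix w (lWord hd m) →
      ∃ k : ℤ, k ≤ m ∧ AppearsAt hd k w) := by
  refine ⟨fun m hm => ⟨specialWord hd m, isBispecial_specialWord hd hm, lWord_eq hd m⟩,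
    ?_, ?_, ?_, ?_⟩
  · intro m hm hmd w
    rw [appearsAt_iff hm, lWord_eq]
    constructor
    · rintro ⟨u, hu, rfl⟩
      generalize ht : m + (d - 1) = t at hu
      cases hu with
      | root => omega
      | step s _ u h h1 h2 =>
        -- The parent has `s ≤ m ≤ d - 1`, so it can only be the root.
        rcases h.time with ⟨rfl, rfl⟩ | h
        · rw [specialWord_of_lt hd hm hmd, List.append_nil, show t - d = m - 1 by omega]
        · omega
    · rintro rfl
      exact ⟨_, branchWord_specialWord hd hm, rfl⟩
  · intro m hm
    rw [appearsAt_iff (by omega), lWord_eq]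
    refine ⟨⟨_, branchWord_specialWord hd (by omega), rfl⟩, fun w hw hne => ?_⟩
    obtain ⟨u, hu, rfl⟩ := (appearsAt_iff (by omega)).1 hw
    have hpre := hu.prefix
    rw [Nat.add_sub_cancel] at hpre
    rw [norm_ofWord_inv, norm_ofWord_inv]
    refine lt_of_le_of_ne hpre.length_le fun hlen => hne ?_
    rw [hpre.eq_of_length hlen]
  · intro m x hx
    refine ⟨fun k hk => fZero_eq_wordAt hk, ?_⟩
    obtain ⟨s, hs, hv⟩ := mem_branchPoints_iff.1 hx
    obtain ⟨u, hu, hw⟩ := exists_hasWord hv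
    rw [fZero_eq_wordAt hx.1, wordAt_eq_of_hasWord hv hs hw, lWord_eq, isSuffix_ofWord_inv_iff]
    exact ⟨u, hu.prefix.trans (specialWord_prefix hd (by omega)), rfl⟩
  · intro m w hw
    rw [lWord_eq, isSuffix_ofWord_inv_iff] at hw
    obtain ⟨u, hu, rfl⟩ := hw
    obtain ⟨t, ht, h⟩ := exists_branchWord_of_prefix hd hu
    rcases h.time with ⟨rfl, rfl⟩ | htd
    -- The root has time 1, which matches the conventional step `1 - (d-1)` for `ε`; the times `t ≥
    -- d` give steps at least 1.
    · refine ⟨-((d : ℤ) - 2), by omega, ?_⟩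
      rw [AppearsAt, if_pos (by omega)]
      exact ⟨rfl, by simp [ofWord]⟩
    · refine ⟨((t - (d - 1) : ℕ) : ℤ), by omega, ?_⟩
      rw [appearsAt_iff (by omega), Nat.sub_add_cancel (by omega)]
      exact ⟨u, h, rfl⟩
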